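/- Let $P$ be a finite poset with minimum $\hat 0$ and maximum $\hat 1$ that is ranked of rank $n$: there is $\rho\colon P\to\mathbb{N}$ with $\rho(\hat 0)=0$, $\rho(t')=\rho(t)+1$ whenever $t'$ covers $t$, and $\rho(\hat 1)=n$. Let $$F_P(x_1,x_2,\dots)=\sum_{\hat 0\le t_1\le\cdots\le t_k<\hat 1} x_1^{\rho(t_1)}x_2^{\rho(t_2)-\rho(t_1)}\cdots x_{k+1}^{n-\rho(t_k)},$$ summed over all $k\ge 0$ and all such multichains, and suppose that $P$ is flag-symmetric, i.e. $F_P$ is a symmetric function. Let $\mathcal M(P)$ be the set of maximal chains of $P$, let $L$ be a totally ordered set, and let $\Lambda\colon\mathcal M(P)\to L^n$, $\Lambda(c)=(\Lambda_1(c),\dots,\Lambda_n(c))$, be a labeling. * $\Lambda$ is an *S-labeling* if it is injective and, for every maximal chain $c=(\hat 0=w^0\lessdot w^1\lessdot\cdots\lessdot w^n=\hat 1)$ and every $1\le i\le n-1$ with $\Lambda_i(c)\ne\Lambda_{i+1}(c)$, there is a unique maximal chain $c'$ that differs from $c$ only at rank $i$ and whose label sequence is obtained from $\Lambda(c)$ by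 interchanging the $i$-th and $(i+1)$-st entries. * $\Lambda$ is a *C-labeling* if each $\Lambda_r(c)$ depends only on $w^0\lessdot\cdots\lessdot w^r$. * A C-labeling $\Lambda$ is an *R-labeling* (respectively *R\*-labeling*) if every chain $\hat 0=w^0\lessdot w^1\lessdot\cdots\lessdot w^r<u$ has a unique completion $w^0\lessdot\cdots\lessdot w^r\lessdot w^{r+1}\lessdot\cdots\lessdot w^s=u$ such that $\Lambda_{r+1}(c)\le\Lambda_{r+2}(c)\le\cdots\le\Lambda_s(c)$ (respectively $\Lambda_{r+1}(c)<\Lambda_{r+2}(c)<\cdots<\Lambda_s(c)$) for any maximal chain $c$ beginning with $w^0\lessdot\cdots\lessdot w^s$. * An *RS-labeling* (*R\*S-labeling*) is one that is both an R-labeling (R\*-labeling) and an S-labeling. Suppose that $\Lambda$ is an S-labeling. Then the set of label sequences is closed under permuting coordinates, so the symmetric group $S_n$ acts on $\mathcal M(P)$ by $\Lambda(\sigma\cdot c)=\sigma\cdot\Lambda(c)$. Let $\psi$ be the character of the resulting representation of $S_n$ on $\mathbb{C}\mathcal M(P)$, and let $\mathrm{ch}(\psi)=\frac1{n!}\sum_{\sigma\in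 S_n}\psi(\sigma)\,p_{\mathrm{type}(\sigma)}$ be its Frobenius characteristic, where $\mathrm{type}(\sigma)$ is the cycle type of $\sigma$ and $p_\lambda$ is the power sum symmetric function. **(a)** If $\Lambda$ is an RS-labeling, then there is a partition $\nu$ of $n$ such that $F_P=\mathrm{ch}(\psi)=h_\nu$ (the complete homogeneous symmetric function) and $P\cong C_{\nu_1+1}\times C_{\nu_2+1}\times\cdots$, where $C_i$ is the chain with $i$ elements. **(b)** If $\Lambda$ is an R\*S-labeling, then $\mathrm{ch}(\psi)=\omega F_P$, where $\omega$ is the standard involution on symmetric functions ($\omega(e_r)=h_r$ for all $r$); hence $F_P$ is $e$-positive, i.e. a linear combination of the elementary symmetric functions $e_\nu$, $\nu\vdash n$, with nonnegative integer coefficients. -/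

import Mathlib

noncomputable section

namespace FlagSymm

/-! ## Symmetric functions in infinitely many variables -/

/-- The algebra of symmetric functions over `R` in the variables `x_0, x_1, x_2, …`: formal power
series of bounded degree that are invariant under all permutations of the variables. -/
def SymmFun (R : Type*) [CommRing R] : Subalgebra R (MvPowerSeries ℕ R) where
  carrier := {f | (∃ N : ℕ, ∀ d : ℕ →₀ ℕ, MvPowerSeries.coeff d f ≠ 0 → d.degree ≤ N) ∧
    ∀ σ : Equiv.Perm ℕ, MvPowerSeries.renameEquiv R σ f = f}
  mul_mem' := by
    rintro f g ⟨⟨N, hN⟩, hf⟩ ⟨⟨M, hM⟩, hg⟩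
    refine ⟨⟨N + M, fun d hd => ?_⟩, fun σ => by rw [map_mul, hf, hg]⟩
    classical
    rw [MvPowerSeries.coeff_mul] at hd
    obtain ⟨⟨a, b⟩, hab, h⟩ := Finset.exists_ne_zero_of_sum_ne_zero hd
    rw [Finset.HasAntidiagonal.mem_antidiagonal] at hab
    have h1 := hN a (left_ne_zero_of_mul h)
    have h2 := hM b (right_ne_zero_of_mul h)
    have h3 : d.degree = a.degree + b.degree := by rw [← hab]; simp
    omega
  add_mem' := by
    rintro f g ⟨⟨N, hN⟩, hf⟩ ⟨⟨M, hM⟩, hg⟩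
    refine ⟨⟨N + M, fun d hd => ?_⟩, fun σ => by rw [map_add, hf, hg]⟩
    by_cases h : MvPowerSeries.coeff d f = 0
    · have h2 : MvPowerSeries.coeff d g ≠ 0 := by
        intro h'
        apply hd
        rw [map_add, h, h', add_zero]
      have := hM d h2
      omega
    · have := hN d h
      omega
  algebraMap_mem' := by
    intro r
    refine ⟨⟨0, fun d hd => ?_⟩, fun σ => AlgEquiv.commutes _ r⟩
    classical
    rw [MvPowerSeries.algebraMap_apply, MvPowerSeries.coeff_C] at hd
    have : d = 0 := by
      by_contra h
      simp [h] at hd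
    simp [this]

theorem coeff_renameEquiv {R : Type*} [CommRing R] (σ : Equiv.Perm ℕ) (f : MvPowerSeries ℕ R)
    (d : ℕ →₀ ℕ) : MvPowerSeries.coeff d (MvPowerSeries.renameEquiv R σ f) =
      MvPowerSeries.coeff (d.embDomain σ.symm.toEmbedding) f := by
  have h : d = (d.embDomain σ.symm.toEmbedding).embDomain σ.toEmbedding := by
    ext i
    obtain ⟨j, rfl⟩ := σ.surjective i
    rw [show σ j = σ.toEmbedding j from rfl, Finsupp.embDomain_apply_self]
    conv_rhs => rw [show j = σ.symm.toEmbedding (σ j) by simp]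
    rw [Finsupp.embDomain_apply_self]
    rfl
  conv_lhs => rw [h]
  exact MvPowerSeries.coeff_embDomain_rename σ.toEmbedding f _

/-- A power series of bounded degree whose coefficients are invariant under permuting exponents
is a symmetric function. -/
theorem mem_symmFun_of_coeff {R : Type*} [CommRing R] {f : MvPowerSeries ℕ R} (N : ℕ)
    (hN : ∀ d : ℕ →₀ ℕ, MvPowerSeries.coeff d f ≠ 0 → d.degree ≤ N)
    (hf : ∀ (σ : Equiv.Perm ℕ) (d : ℕ →₀ ℕ),
      MvPowerSeries.coeff (d.embDomain σ.toEmbedding) f = MvPowerSeries.coeff d f) :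
    f ∈ SymmFun R := by
  refine ⟨⟨N, hN⟩, fun σ => ?_⟩
  ext d
  rw [coeff_renameEquiv, hf]

theorem degree_embDomain {ι κ : Type*} (σ : ι ↪ κ) (d : ι →₀ ℕ) :
    (d.embDomain σ).degree = d.degree := by
  simp [Finsupp.degree_apply, Finsupp.support_embDomain, Finset.sum_map]

theorem forall_embDomain_le_one (σ : Equiv.Perm ℕ) (d : ℕ →₀ ℕ) :
    (∀ i, d.embDomain σ.toEmbedding i ≤ 1) ↔ ∀ i, d i ≤ 1 := by
  constructor
  · intro h i
    have := h (σ.toEmbedding i)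
    rwa [Finsupp.embDomain_apply_self] at this
  · intro h i
    obtain ⟨j, rfl⟩ := σ.surjective i
    have := h j
    rwa [← Finsupp.embDomain_apply_self σ.toEmbedding] at this

section Generators

variable (R : Type*) [CommRing R]

open Classical in
/-- The elementary symmetric function `e_r`: the sum of all squarefree monomials of degree `r`. -/
def elem (r : ℕ) : SymmFun R :=
  ⟨fun d => if d.degree = r ∧ ∀ i, d i ≤ 1 then 1 else 0, by
    refine mem_symmFun_of_coeff r (fun d hd => ?_) (fun σ d => ?_)
    · by_contra h
      exact hd (if_neg fun h' => h h'.1.le)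
    · change (if _ then _ else _) = (if _ then _ else _)
      simp only [degree_embDomain, forall_embDomain_le_one]⟩

open Classical in
/-- The complete homogeneous symmetric function `h_r`: the sum of all monomials of degree `r`. -/
def complete (r : ℕ) : SymmFun R :=
  ⟨fun d => if d.degree = r then 1 else 0, by
    refine mem_symmFun_of_coeff r (fun d hd => ?_) (fun σ d => ?_)
    · by_contra h
      exact hd (if_neg fun h' => h h'.le)
    · change (if _ then _ else _) = (if _ then _ else _)
      simp only [degree_embDomain]⟩

open Classical in
/-- The power sum symmetric function `p_r = x_0 ^ r + x_1 ^ r + ⋯` (used only for `1 ≤ r`). -/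
def psum (r : ℕ) : SymmFun R :=
  ⟨fun d => if ∃ i, d = Finsupp.single i r then 1 else 0, by
    refine mem_symmFun_of_coeff r (fun d hd => ?_) (fun σ d => ?_)
    · by_contra h
      refine hd (if_neg ?_)
      rintro ⟨i, rfl⟩
      exact h (by simp)
    · change (if _ then _ else _) = (if _ then _ else _)
      congr 1
      refine propext ⟨?_, ?_⟩
      · rintro ⟨i, hi⟩
        refine ⟨σ.symm i, Finsupp.embDomain_injective σ.toEmbedding ?_⟩
        rw [hi, Finsupp.embDomain_single]
        simp
      · rintro ⟨i, rfl⟩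
        exact ⟨σ i, by rw [Finsupp.embDomain_single]; rfl⟩⟩

/-- `e_ν = e_{ν_1} e_{ν_2} ⋯`. -/
def elemPart {n : ℕ} (ν : n.Partition) : SymmFun R := (ν.parts.map (elem R)).prod

/-- `h_ν = h_{ν_1} h_{ν_2} ⋯`. -/
def completePart {n : ℕ} (ν : n.Partition) : SymmFun R := (ν.parts.map (complete R)).prod

/-- `p_ν = p_{ν_1} p_{ν_2} ⋯`. -/
def psumPart {n : ℕ} (ν : n.Partition) : SymmFun R := (ν.parts.map (psum R)).prod

end Generators

/-! ## The fundamental theorem and the involution `ω` -/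

section Fundamental

variable (R : Type*) [CommRing R]

/-- The polynomial ring in `e_1, e_2, …` maps to the algebra of symmetric functions. -/
def elemHom : MvPolynomial ℕ R →ₐ[R] SymmFun R :=
  MvPolynomial.aeval fun r => elem R (r + 1)

/-- Setting all variables but the first `N` to zero. -/
def restrict (N : ℕ) : SymmFun R →ₐ[R] MvPowerSeries (Fin N) R :=
  (MvPowerSeries.killCompl (R := R) (Fin.valEmbedding (n := N))).comp (SymmFun R).val

theorem coeff_esymm_fin (N r : ℕ) (d : Fin N →₀ ℕ) [Decidable (d.degree = r ∧ ∀ i, d i ≤ 1)] :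
    MvPolynomial.coeff d (MvPolynomial.esymm (Fin N) R r) =
      if d.degree = r ∧ ∀ i, d i ≤ 1 then 1 else 0 := by
  classical
  have key : ∀ (t : Finset (Fin N)) (i : Fin N),
      (∑ j ∈ t, Finsupp.single j 1 : Fin N →₀ ℕ) i = if i ∈ t then 1 else 0 := by
    intro t i
    simp [Finsupp.finsetSum_apply, Finsupp.single_apply]
  rw [MvPolynomial.esymm_eq_sum_monomial, MvPolynomial.coeff_sum]
  simp only [MvPolynomial.coeff_monomial]
  split_ifs with h
  · obtain ⟨h1, h2⟩ := h
    have hd : (∑ j ∈ d.support, Finsupp.single j 1 : Fin N →₀ ℕ) = d := by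
      ext i
      rw [key]
      have := h2 i
      split_ifs with hi
      · rw [Finsupp.mem_support_iff] at hi
        omega
      · rw [Finsupp.notMem_support_iff] at hi
        omega
    rw [Finset.sum_eq_single d.support]
    · rw [if_pos hd]
    · intro t _ ht
      rw [if_neg]
      intro h
      apply ht
      ext i
      rw [Finsupp.mem_support_iff, ← h, key]
      simp
    · intro hm
      exfalso
      apply hm
      rw [Finset.mem_powersetCard_univ, ← h1]
      rw [Finsupp.degree, Finset.card_eq_sum_ones]
      apply Finset.sum_congr rfl
      intro i hi
      rw [Finsupp.mem_support_iff] at hi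
      have := h2 i
      omega
  · apply Finset.sum_eq_zero
    intro t ht
    rw [if_neg]
    rintro rfl
    apply h
    rw [Finset.mem_powersetCard_univ] at ht
    refine ⟨by rw [map_sum]; simp [ht], fun i => ?_⟩
    rw [key]
    split_ifs <;> simp

theorem restrict_elem (N r : ℕ) : restrict R N (elem R r) =
    ((MvPolynomial.esymm (Fin N) R r : MvPolynomial (Fin N) R) : MvPowerSeries (Fin N) R) := by
  classical
  ext d
  rw [MvPolynomial.coeff_coe, coeff_esymm_fin]
  change (if (d.embDomain Fin.valEmbedding).degree = r ∧
    ∀ i, d.embDomain Fin.valEmbedding i ≤ 1 then (1 : R) else 0) = _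
  congr 1
  refine propext (and_congr ?_ ⟨fun h i => ?_, fun h i => ?_⟩)
  · rw [degree_embDomain]
  · have := h (Fin.valEmbedding i)
    rwa [Finsupp.embDomain_apply_self] at this
  · by_cases hi : i ∈ Set.range (Fin.valEmbedding (n := N))
    · obtain ⟨j, rfl⟩ := hi
      rw [Finsupp.embDomain_apply_self]
      exact h j
    · rw [Finsupp.embDomain_of_notMem_range _ _ _ hi]
      exact zero_le_one

theorem restrict_elemHom (N : ℕ) (Q : MvPolynomial (Fin N) R) :
    restrict R N (elemHom R (MvPolynomial.rename Fin.val Q)) =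
      (((MvPolynomial.esymmAlgHom (Fin N) R N Q : MvPolynomial.symmetricSubalgebra (Fin N) R) :
        MvPolynomial (Fin N) R) : MvPowerSeries (Fin N) R) := by
  have : ((restrict R N).comp (elemHom R)).comp (MvPolynomial.rename Fin.val) =
      ((MvPolynomial.coeToMvPowerSeries.algHom R).comp
        (MvPolynomial.symmetricSubalgebra (Fin N) R).val).comp
          (MvPolynomial.esymmAlgHom (Fin N) R N) := by
    apply MvPolynomial.algHom_ext
    intro i
    simp only [AlgHom.comp_apply, MvPolynomial.rename_X]
    rw [elemHom, MvPolynomial.aeval_X, restrict_elem, MvPolynomial.esymmAlgHom,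
      MvPolynomial.aeval_X]
    simp [MvPolynomial.coeToMvPowerSeries.algHom_apply]
  have h := DFunLike.congr_fun this Q
  simpa [MvPolynomial.coeToMvPowerSeries.algHom_apply] using h

theorem elemHom_injective : Function.Injective (elemHom R) := by
  rw [injective_iff_map_eq_zero]
  intro Q hQ
  obtain ⟨N, Q', rfl⟩ : ∃ (N : ℕ) (Q' : MvPolynomial (Fin N) R),
      Q = MvPolynomial.rename Fin.val Q' := by
    refine ⟨Q.vars.sup id + 1, ?_⟩
    obtain ⟨q, hq⟩ := MvPolynomial.exists_rename_eq_of_vars_subset_range Q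
      (Fin.val : Fin (Q.vars.sup id + 1) → ℕ) Fin.val_injective (fun i hi =>
        ⟨⟨i, Nat.lt_succ_of_le (Finset.le_sup (f := id) hi)⟩, rfl⟩)
    exact ⟨q, hq.symm⟩
  have h := restrict_elemHom R N Q'
  rw [hQ, map_zero] at h
  have h2 : MvPolynomial.esymmAlgHom (Fin N) R N Q' = 0 := by
    apply Subtype.ext
    apply MvPolynomial.coe_injective
    rw [← h]
    simp
  rw [(injective_iff_map_eq_zero _).1 (MvPolynomial.esymmAlgHom_fin_injective R le_rfl) Q' h2,
    map_zero]

variable {R}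

/-- Homogeneity of degree `m`. -/
def IsHom (f : SymmFun R) (m : ℕ) : Prop :=
  ∀ d : ℕ →₀ ℕ, MvPowerSeries.coeff d f.1 ≠ 0 → d.degree = m

theorem IsHom.mul {f g : SymmFun R} {m k : ℕ} (hf : IsHom f m) (hg : IsHom g k) :
    IsHom (f * g) (m + k) := by
  classical
  intro d hd
  rw [MulMemClass.coe_mul, MvPowerSeries.coeff_mul] at hd
  obtain ⟨⟨a, b⟩, hab, h⟩ := Finset.exists_ne_zero_of_sum_ne_zero hd
  rw [Finset.HasAntidiagonal.mem_antidiagonal] at hab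
  rw [← hf a (left_ne_zero_of_mul h), ← hg b (right_ne_zero_of_mul h), ← hab]
  simp

theorem isHom_algebraMap (a : R) : IsHom (algebraMap R (SymmFun R) a) 0 := by
  classical
  intro d hd
  change MvPowerSeries.coeff d (MvPowerSeries.C a) ≠ 0 at hd
  rw [MvPowerSeries.coeff_C] at hd
  have : d = 0 := by
    by_contra h
    simp [h] at hd
  simp [this]

theorem isHom_elem (r : ℕ) : IsHom (elem R r) r := by
  intro d hd
  by_contra h
  exact hd (if_neg fun h' => h h'.1)

theorem IsHom.pow {f : SymmFun R} {m : ℕ} (hf : IsHom f m) (k : ℕ) : IsHom (f ^ k) (k * m) := by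
  induction k with
  | zero =>
    have := isHom_algebraMap (1 : R)
    simpa using this
  | succ k ih =>
    rw [pow_succ, Nat.succ_mul]
    exact ih.mul hf

theorem isHom_elemHom_monomial (u : ℕ →₀ ℕ) (a : R) :
    ∃ m, IsHom (elemHom R (MvPolynomial.monomial u a)) m := by
  induction u using Finsupp.induction_linear generalizing a with
  | zero =>
    refine ⟨0, ?_⟩
    have : elemHom R (MvPolynomial.monomial 0 a) = algebraMap R (SymmFun R) a :=
      AlgHom.commutes _ a
    rw [this]
    exact isHom_algebraMap a
  | add u v hu hv =>
    obtain ⟨m, hm⟩ := hu a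
    obtain ⟨k, hk⟩ := hv 1
    refine ⟨m + k, ?_⟩
    have : MvPolynomial.monomial (u + v) a =
        MvPolynomial.monomial u a * MvPolynomial.monomial v 1 := by
      rw [MvPolynomial.monomial_mul, mul_one]
    rw [this, map_mul]
    exact hm.mul hk
  | single i k =>
    refine ⟨0 + k * (i + 1), ?_⟩
    rw [← MvPolynomial.C_mul_X_pow_eq_monomial, map_mul, map_pow]
    refine IsHom.mul ?_ (IsHom.pow ?_ k)
    · have : elemHom R (MvPolynomial.C a) = algebraMap R (SymmFun R) a :=
        AlgHom.commutes _ a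
      rw [this]
      exact isHom_algebraMap a
    · rw [elemHom, MvPolynomial.aeval_X]
      exact isHom_elem _

theorem exists_elemHom_eq_truncation (N : ℕ) (Q : MvPolynomial ℕ R) :
    ∃ Q' : MvPolynomial ℕ R, ∀ d : ℕ →₀ ℕ, MvPowerSeries.coeff d (elemHom R Q').1 =
      if d.degree ≤ N then MvPowerSeries.coeff d (elemHom R Q).1 else 0 := by
  induction Q using MvPolynomial.induction_on' with
  | monomial u a =>
    obtain ⟨m, hm⟩ := isHom_elemHom_monomial u a
    by_cases h : m ≤ N
    · refine ⟨MvPolynomial.monomial u a, fun d => ?_⟩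
      split_ifs with hd
      · rfl
      · by_contra h'
        have := hm d h'
        omega
    · refine ⟨0, fun d => ?_⟩
      rw [map_zero]
      split_ifs with hd
      · by_contra h'
        have := hm d (fun h'' => h' (by rw [h'']; simp))
        omega
      · simp
  | add p q hp hq =>
    obtain ⟨p', hp'⟩ := hp
    obtain ⟨q', hq'⟩ := hq
    refine ⟨p' + q', fun d => ?_⟩
    rw [map_add, map_add, AddMemClass.coe_add, AddMemClass.coe_add, map_add, map_add, hp', hq']
    split_ifs <;> simp

theorem coeff_restrict (N : ℕ) (f : SymmFun R) (d : Fin N →₀ ℕ) :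
    MvPowerSeries.coeff d (restrict R N f) =
      MvPowerSeries.coeff (d.embDomain Fin.valEmbedding) f.1 := rfl

theorem coeff_embDomain_perm (f : SymmFun R) (σ : Equiv.Perm ℕ) (d : ℕ →₀ ℕ) :
    MvPowerSeries.coeff (d.embDomain σ.toEmbedding) f.1 = MvPowerSeries.coeff d f.1 := by
  have h := coeff_renameEquiv σ.symm f.1 d
  rw [f.2.2] at h
  exact h.symm

/-- A symmetric function of degree at most `N` is determined by its restriction to `N` variables. -/
theorem eq_zero_of_restrict_eq_zero (N : ℕ) (f : SymmFun R)
    (hN : ∀ d : ℕ →₀ ℕ, MvPowerSeries.coeff d f.1 ≠ 0 → d.degree ≤ N)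
    (hf : restrict R N f = 0) : f = 0 := by
  apply Subtype.ext
  ext d
  by_contra hd
  have hdN := hN d hd
  have hcard : d.support.card ≤ N := by
    refine le_trans ?_ hdN
    rw [Finsupp.degree_apply, Finset.card_eq_sum_ones]
    refine Finset.sum_le_sum fun i hi => ?_
    rw [Finsupp.mem_support_iff] at hi
    omega
  obtain ⟨σ, hσ⟩ : ∃ σ : Equiv.Perm ℕ, ∀ i ∈ d.support, σ i < N := by
    obtain ⟨t, ht, htc⟩ := Finset.exists_subset_card_eq
      (s := Finset.range N) (n := d.support.card) (by simpa using hcard)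
    have e : {i // i ∈ d.support} ≃ {i // i ∈ t} := Finset.equivOfCardEq htc.symm
    refine ⟨e.extendSubtype, fun i hi => ?_⟩
    have := e.extendSubtype_mem i hi
    exact Finset.mem_range.1 (ht this)
  obtain ⟨d', hd'⟩ : ∃ d' : Fin N →₀ ℕ,
      d'.embDomain Fin.valEmbedding = d.embDomain σ.toEmbedding := by
    rw [← Set.mem_range, Finsupp.mem_range_embDomain_iff]
    intro i hi
    rw [Finsupp.support_embDomain] at hi
    obtain ⟨j, hj, rfl⟩ := Finset.mem_map.1 (Finset.mem_coe.1 hi)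
    exact ⟨⟨σ j, hσ j hj⟩, rfl⟩
  have h := coeff_restrict N f d'
  rw [hf, hd', coeff_embDomain_perm] at h
  exact hd h.symm

theorem exists_symmetric_polynomial (N : ℕ) (f : SymmFun R) :
    ∃ p : MvPolynomial.symmetricSubalgebra (Fin N) R,
      ((p : MvPolynomial (Fin N) R) : MvPowerSeries (Fin N) R) = restrict R N f := by
  classical
  obtain ⟨M, hM⟩ := f.2.1
  have hfin : {d : Fin N →₀ ℕ | d.degree ≤ M}.Finite := by
    refine (Set.finite_Iic (Finsupp.equivFunOnFinite.symm fun _ => M : Fin N →₀ ℕ)).subset ?_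
    intro d hd i
    exact le_trans (Finsupp.le_degree i d) hd
  let p : MvPolynomial (Fin N) R :=
    MvPowerSeries.truncFinset R hfin.toFinset (restrict R N f)
  have hp : (p : MvPowerSeries (Fin N) R) = restrict R N f := by
    ext d
    rw [MvPolynomial.coeff_coe, MvPowerSeries.coeff_truncFinset]
    split_ifs with h
    · rfl
    · by_contra h'
      apply h
      rw [Set.Finite.mem_toFinset]
      have := hM _ (fun h0 => h' (by rw [coeff_restrict, h0]))
      rwa [degree_embDomain] at this
  refine ⟨⟨p, ?_⟩, hp⟩
  intro e
  ext d
  have hd : d = (d.mapDomain e.symm).mapDomain e := by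
    rw [← Finsupp.mapDomain_comp]
    simp
  conv_lhs => rw [hd]
  rw [MvPolynomial.coeff_rename_mapDomain _ e.injective]
  rw [← MvPolynomial.coeff_coe, ← MvPolynomial.coeff_coe, hp, coeff_restrict, coeff_restrict]
  have : Finite {i : ℕ // i < N} := Finite.of_equiv _ (Fin.equivSubtype (n := N))
  let E : {i : ℕ // i < N} ≃ {i : ℕ // i < N} :=
    Fin.equivSubtype.symm.trans (e.trans Fin.equivSubtype)
  have key : d.embDomain Fin.valEmbedding =
      ((d.mapDomain e.symm).embDomain Fin.valEmbedding).embDomain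
        E.extendSubtype.toEmbedding := by
    simp only [Finsupp.embDomain_eq_mapDomain, ← Finsupp.mapDomain_comp]
    congr 1
    funext i
    simp only [Function.comp_apply, Equiv.coe_toEmbedding]
    have h2 := Equiv.extendSubtype_apply_of_mem E (e.symm i : ℕ) (e.symm i).2
    refine Eq.trans ?_ h2.symm
    simp [E, Fin.equivSubtype]
  rw [key, coeff_embDomain_perm]

theorem elemHom_surjective : Function.Surjective (elemHom R) := by
  intro f
  obtain ⟨N, hN⟩ := f.2.1
  obtain ⟨p, hp⟩ := exists_symmetric_polynomial N f
  obtain ⟨Q, rfl⟩ := (MvPolynomial.esymmAlgHom_fin_bijective R N).2 p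
  rw [← restrict_elemHom] at hp
  obtain ⟨Q', hQ'⟩ := exists_elemHom_eq_truncation N (MvPolynomial.rename Fin.val Q)
  refine ⟨Q', ?_⟩
  rw [← sub_eq_zero]
  refine eq_zero_of_restrict_eq_zero N _ (fun d hd => ?_) ?_
  · by_contra h
    apply hd
    rw [AddSubgroupClass.coe_sub, map_sub, hQ', if_neg h]
    by_cases h0 : MvPowerSeries.coeff d f.1 = 0
    · rw [h0, sub_zero]
    · exact absurd (hN d h0) h
  · rw [map_sub, sub_eq_zero, ← hp]
    ext d
    rw [coeff_restrict, coeff_restrict, hQ']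
    split_ifs with h
    · rfl
    · rw [← coeff_restrict, hp, coeff_restrict]
      by_contra h0
      exact h (hN _ (Ne.symm h0))

variable (R)

/-- The fundamental theorem of symmetric functions: `e_1, e_2, …` are algebraically independent
and generate the algebra of symmetric functions. -/
def elemEquiv : MvPolynomial ℕ R ≃ₐ[R] SymmFun R :=
  AlgEquiv.ofBijective (elemHom R) ⟨elemHom_injective R, elemHom_surjective⟩

/-- The standard involution `ω`: the algebra endomorphism with `ω(e_r) = h_r` for `1 ≤ r`. -/
def omega : SymmFun R →ₐ[R] SymmFun R :=
  (MvPolynomial.aeval fun r => complete R (r + 1)).comp (elemEquiv R).symm.toAlgHom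

theorem elem_zero : elem R 0 = 1 := by
  classical
  apply Subtype.ext
  ext d
  change (if d.degree = 0 ∧ ∀ i, d i ≤ 1 then (1 : R) else 0) =
    MvPowerSeries.coeff d (1 : MvPowerSeries ℕ R)
  rw [MvPowerSeries.coeff_one]
  congr 1
  refine propext ⟨fun h => (Finsupp.degree_eq_zero_iff d).1 h.1, ?_⟩
  rintro rfl
  simp

theorem complete_zero : complete R 0 = 1 := by
  classical
  apply Subtype.ext
  ext d
  change (if d.degree = 0 then (1 : R) else 0) = MvPowerSeries.coeff d (1 : MvPowerSeries ℕ R)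
  rw [MvPowerSeries.coeff_one]
  congr 1
  exact propext (Finsupp.degree_eq_zero_iff d)

/-- The property that characterizes `ω`. -/
theorem omega_elem (r : ℕ) : omega R (elem R r) = complete R r := by
  rcases r with _ | r
  · rw [elem_zero, complete_zero, map_one]
  · have h : (elemEquiv R).symm (elem R (r + 1)) = MvPolynomial.X r := by
      rw [AlgEquiv.symm_apply_eq]
      exact (MvPolynomial.aeval_X (fun r => elem R (r + 1)) r).symm
    change MvPolynomial.aeval (fun r => complete R (r + 1))
      ((elemEquiv R).symm (elem R (r + 1))) = _
    rw [h, MvPolynomial.aeval_X]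

end Fundamental

/-! ## Maximal chains, flag series and labelings -/

/-- Sequences `⊥ = w 0 ⋖ w 1 ⋖ ⋯ ⋖ w n = ⊤`; in a finite ranked poset of rank `n` these are
exactly the maximal chains. -/
@[ext]
structure MaxChain (P : Type*) [PartialOrder P] [BoundedOrder P] (n : ℕ) where
  /-- The element of the chain at each rank. -/
  elt : Fin (n + 1) → P
  bot_eq : elt 0 = ⊥
  top_eq : elt (Fin.last n) = ⊤
  covBy : ∀ i : Fin n, elt i.castSucc ⋖ elt i.succ

/-- The power series `F_P = ∑ x_0 ^ ρ(t_0) x_1 ^ (ρ(t_1) - ρ(t_0)) ⋯ x_k ^ (n - ρ(t_{k-1}))`, summed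
over all `0 ≤ k` and all multichains `⊥ ≤ t_0 ≤ ⋯ ≤ t_{k-1} < ⊤`, where `ρ = grade ℕ` is the rank
function. A multichain is recorded as the weakly increasing sequence
`t_0, …, t_{k-1}, ⊤, ⊤, ⊤, …`, and the coefficient of `x ^ d` counts the multichains for which
`d_0 = ρ(t_0)` and `d_i = ρ(t_i) - ρ(t_{i-1})` for `1 ≤ i`, that is,
`ρ(t_i) = d_0 + ⋯ + d_i` for all `i`. -/
def flagSeries (R : Type*) [CommRing R] (P : Type*) [PartialOrder P] [BoundedOrder P]
    [GradeMinOrder ℕ P] : MvPowerSeries ℕ R :=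
  fun d => (Nat.card {t : ℕ → P // Monotone t ∧ (∃ k, ∀ i, k ≤ i → t i = ⊤) ∧
    ∀ i, grade ℕ (t i) = ∑ j ∈ Finset.range (i + 1), d j} : R)

/-- `P` is flag-symmetric if `F_P` is a symmetric function. -/
def IsFlagSymmetric (P : Type*) [PartialOrder P] [BoundedOrder P] [GradeMinOrder ℕ P] : Prop :=
  flagSeries ℂ P ∈ SymmFun ℂ

/-- The flag symmetric function `F_P` of a flag-symmetric poset. -/
def flagSymmFun {P : Type*} [PartialOrder P] [BoundedOrder P] [GradeMinOrder ℕ P]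
    (h : IsFlagSymmetric P) : SymmFun ℂ :=
  ⟨flagSeries ℂ P, h⟩

section Labelings

variable {P : Type*} [PartialOrder P] [BoundedOrder P] {n : ℕ} {L : Type*}

/-- The labels up to position `r` depend only on the part of the chain up to rank `r`.
(`Λ c i` is the label at position `i + 1`, the one between the ranks `i` and `i + 1`.) -/
def IsCLabeling (Λ : MaxChain P n → Fin n → L) : Prop :=
  ∀ (c c' : MaxChain P n) (i : Fin n), (∀ j, j ≤ i.succ → c.elt j = c'.elt j) → Λ c i = Λ c' i

/-- `v` is a completion `w 0 ⋖ ⋯ ⋖ w r ⋖ ⋯ ⋖ w s = u` of the chain `w 0 ⋖ ⋯ ⋖ w r < u` formed by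
the first elements of `c`, and `c'` is a maximal chain beginning with `v`. -/
def IsCompletion (c : MaxChain P n) (r s : Fin (n + 1)) (u : P) (v : Set.Iic s → P)
    (c' : MaxChain P n) : Prop :=
  (∀ j : Set.Iic s, (j : Fin (n + 1)) ≤ r → v j = c.elt j) ∧ v ⟨s, Set.self_mem_Iic⟩ = u ∧
    ∀ j : Set.Iic s, v j = c'.elt j

/-- The positions of the labels `Λ_{r+1}, …, Λ_s`. -/
def labelPositions (r s : Fin (n + 1)) : Set (Fin n) :=
  {i | r ≤ i.castSucc ∧ i.succ ≤ s}

/-- `R`-labelings: `C`-labelings such that every chain `⊥ = w 0 ⋖ ⋯ ⋖ w r < u` has a unique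
completion by covering relations whose new labels increase weakly. The chains `w 0 ⋖ ⋯ ⋖ w r` are
the initial parts of maximal chains, and `s` is the rank of `u`. -/
def IsRLabeling [GradeMinOrder ℕ P] [LinearOrder L] (Λ : MaxChain P n → Fin n → L) : Prop :=
  IsCLabeling Λ ∧ ∀ (c : MaxChain P n) (r s : Fin (n + 1)) (u : P),
    c.elt r < u → grade ℕ u = (s : ℕ) →
      ∃! v : Set.Iic s → P, ∃ c' : MaxChain P n,
        IsCompletion c r s u v c' ∧ MonotoneOn (Λ c') (labelPositions r s)

/-- `R*`-labelings: as `R`-labelings, but with strictly increasing labels. -/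
def IsRStarLabeling [GradeMinOrder ℕ P] [LinearOrder L] (Λ : MaxChain P n → Fin n → L) : Prop :=
  IsCLabeling Λ ∧ ∀ (c : MaxChain P n) (r s : Fin (n + 1)) (u : P),
    c.elt r < u → grade ℕ u = (s : ℕ) →
      ∃! v : Set.Iic s → P, ∃ c' : MaxChain P n,
        IsCompletion c r s u v c' ∧ StrictMonoOn (Λ c') (labelPositions r s)

/-- `S`-labelings: `Λ` is injective, and whenever two neighbouring labels of `c` (at the positions
`i` and `j = i + 1`) differ, there is a unique maximal chain that agrees with `c` except at the rank
between them and whose label sequence is that of `c` with these two labels interchanged. -/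
def IsSLabeling (Λ : MaxChain P n → Fin n → L) : Prop :=
  Function.Injective Λ ∧ ∀ (c : MaxChain P n) (i j : Fin n), (j : ℕ) = i + 1 → Λ c i ≠ Λ c j →
    ∃! c' : MaxChain P n, (∀ k, k ≠ i.succ → c'.elt k = c.elt k) ∧ Λ c' = Λ c ∘ Equiv.swap i j

/-- The label sequences of an `S`-labeling are closed under permuting coordinates. -/
theorem IsSLabeling.exists_eq_comp {Λ : MaxChain P n → Fin n → L} (hS : IsSLabeling Λ)
    (σ : Equiv.Perm (Fin n)) (c : MaxChain P n) : ∃ c' : MaxChain P n, Λ c' = Λ c ∘ σ := by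
  rcases n with _ | n
  · exact ⟨c, funext fun i => i.elim0⟩
  · have hσ : σ ∈ Submonoid.closure
        (Set.range fun i : Fin n => Equiv.swap i.castSucc i.succ) := by
      rw [Equiv.Perm.mclosure_swap_castSucc_succ]
      trivial
    induction hσ using Submonoid.closure_induction generalizing c with
    | mem x hx =>
      obtain ⟨i, rfl⟩ := hx
      by_cases h : Λ c i.castSucc = Λ c i.succ
      · refine ⟨c, funext fun k => ?_⟩
        simp only [Function.comp_apply, Equiv.swap_apply_def]
        split_ifs with h1 h2
        · rw [h1, h]
        · rw [h2, h]
        · rfl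
      · obtain ⟨c', hc', -⟩ := hS.2 c i.castSucc i.succ (by simp) h
        exact ⟨c', hc'.2⟩
    | one => exact ⟨c, rfl⟩
    | mul x y _ _ hx hy =>
      obtain ⟨c₁, h₁⟩ := hx c
      obtain ⟨c₂, h₂⟩ := hy c₁
      exact ⟨c₂, by rw [h₂, h₁]; rfl⟩

/-- The action of `S_n` on maximal chains induced from the action on label sequences by permuting
coordinates, `(σ • a) i = a (σ⁻¹ i)`. -/
@[reducible]
def IsSLabeling.action {Λ : MaxChain P n → Fin n → L} (hS : IsSLabeling Λ) :
    MulAction (Equiv.Perm (Fin n)) (MaxChain P n) where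
  smul σ c := (hS.exists_eq_comp σ⁻¹ c).choose
  one_smul c := hS.1 (hS.exists_eq_comp 1⁻¹ c).choose_spec
  mul_smul σ τ c := hS.1 (by
    have h₁ := (hS.exists_eq_comp (σ * τ)⁻¹ c).choose_spec
    have h₂ := (hS.exists_eq_comp τ⁻¹ c).choose_spec
    have h₃ := (hS.exists_eq_comp σ⁻¹ (hS.exists_eq_comp τ⁻¹ c).choose).choose_spec
    refine h₁.trans (Eq.trans ?_ h₃.symm)
    rw [h₂, mul_inv_rev]
    rfl)

/-- The defining property of the action. -/
theorem IsSLabeling.label_smul {Λ : MaxChain P n → Fin n → L} (hS : IsSLabeling Λ)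
    (σ : Equiv.Perm (Fin n)) (c : MaxChain P n) : Λ (hS.action.smul σ c) = Λ c ∘ ⇑σ⁻¹ :=
  (hS.exists_eq_comp σ⁻¹ c).choose_spec

/-- The character `ψ` of the representation of `S_n` on the complex vector space with basis the
maximal chains. -/
def IsSLabeling.chainCharacter {Λ : MaxChain P n → Fin n → L} (hS : IsSLabeling Λ) :
    Equiv.Perm (Fin n) → ℂ :=
  letI := hS.action
  (Representation.ofMulAction ℂ (Equiv.Perm (Fin n)) (MaxChain P n)).character

end Labelings

/-- The Frobenius characteristic `ch(ψ) = (1 / n!) ∑_σ ψ(σ) p_{type σ}`, where `type σ` is the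
cycle type of `σ`, fixed points included; grouping by conjugacy classes, this is
`∑_λ z_λ⁻¹ ψ(λ) p_λ`. -/
def frobeniusChar {n : ℕ} (ψ : Equiv.Perm (Fin n) → ℂ) : SymmFun ℂ :=
  (n.factorial : ℂ)⁻¹ • ∑ σ : Equiv.Perm (Fin n), ψ σ • psumPart ℂ σ.partition

/-- `e`-positivity of a homogeneous symmetric function of degree `n`: it is a combination of the
`e_ν` with nonnegative (integer) coefficients. -/
def IsEPositive (n : ℕ) (f : SymmFun ℂ) : Prop :=
  ∃ a : n.Partition → ℕ, f = ∑ ν : n.Partition, a ν • elemPart ℂ ν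

end FlagSymm

/-! All three quantities are compared coefficient by coefficient, and each coefficient counts
nonnegative integer matrices with prescribed marginals, encoded as multisets of pairs in `ℕ × L`.

For an S-labeling, injectivity and closure under permutations identify the maximal chains with all
rearrangements of the multisets in `labelMultisets Λ`. The coefficient of `x ^ d` in `p_{type σ}`
counts the `σ`-invariant words of content `d`, and `ψ(σ)` counts the chains with `σ`-invariant label
word. Their product counts the `σ`-invariant words of pairs, so by Burnside's lemma the average over
`σ` counts multisets of pairs, that is, matrices with marginals `d` and `M`. This gives `ch(ψ)` as
the sum over `M` of the product of `h_k`, for `k` the multiplicities in `M`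
(`IsSLabeling.frobeniusChar_chainCharacter`).

For an R-labeling (R*-labeling), a multichain with rank jumps `d` refines uniquely to a maximal
chain whose labels increase weakly (strictly) inside each block of `d`
(`IsIncreasingLabeling.coeff_flagSeries`). Writing the block index above each label gives a
lexicographically sorted two-line array, hence a matrix; strictness says that no pair repeats, so
the matrix has entries 0 and 1 (`IsSLabeling.card_sorted`). Therefore `F_P` is the same sum with
`h_k` in the R case, and with `e_k` in the R* case. Applying `ω` gives (b).

For the product decomposition in (a), sort the labels below an element by the exchanges of the
S-labeling. This keeps the element and ends at the unique weakly increasing chain to it, so the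
element determines the multiset of labels below it (`IsRLabeling.prefixMultiset_eq`). In particular
there is only one total multiset `M`, and `P` is isomorphic to the submultisets of `M`, a product of
chains (`IsRLabeling.exists_labelMultiset`, `nonempty_orderIso_of_submultisets`). -/

namespace FlagSymm

open Finset

/-! ### Coefficients of products as counts of factorizations and words -/

section Coefficients

open Classical in
/-- The coefficients of a product of sums of distinct monomials count factorizations. -/
theorem coeff_prod_indicator {ι : Type*} [Fintype ι] (f : ι → SymmFun ℂ)
    (p : ι → (ℕ →₀ ℕ) → Prop)
    (hf : ∀ i d, MvPowerSeries.coeff d (f i).1 = if p i d then 1 else 0) (d : ℕ →₀ ℕ) :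
    MvPowerSeries.coeff d (∏ i, f i).1 =
      Nat.card {l : ι → ℕ →₀ ℕ // (∀ i, p i (l i)) ∧ ∑ i, l i = d} := by
  have h1 : (∏ i, f i).1 = ∏ i, (f i).1 := map_prod (SymmFun ℂ).val f univ
  rw [h1, MvPowerSeries.coeff_prod]
  simp only [hf, Finset.prod_ite_zero, Finset.prod_const_one]
  rw [Finset.sum_boole, ← Nat.card_eq_finsetCard]
  congr 1
  refine Nat.card_congr (Equiv.subtypeEquiv Finsupp.equivFunOnFinite fun l => ?_)
  simp [mem_finsuppAntidiag, and_comm]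

theorem map_univ_eq_toMultiset_iff {ι : Type*} [Fintype ι] (d : ℕ →₀ ℕ) (f : ι → ℕ) :
    univ.val.map f = Finsupp.toMultiset d ↔ ∑ x, Finsupp.single (f x) 1 = d := by
  rw [← Multiset.toFinsupp_symm_apply, AddEquiv.eq_symm_apply]
  have : Multiset.toFinsupp (univ.val.map f) = ∑ x, Finsupp.single (f x) 1 := by
    rw [← AddEquiv.eq_symm_apply, Multiset.toFinsupp_symm_apply, map_sum]
    simp only [Finsupp.toMultiset_single, one_nsmul]
    rw [← Multiset.sum_map_singleton (univ.val.map f), Multiset.map_map]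
    rfl
  rw [this]

/-- The coefficients of a product of power sums indexed by the fibres of a surjection count the
functions constant on the fibres. -/
theorem coeff_prod_psum_fiber {α ι : Type*} [Fintype α] [Fintype ι] [DecidableEq ι] (π : α → ι)
    (hπ : Function.Surjective π) (d : ℕ →₀ ℕ) :
    MvPowerSeries.coeff d (∏ i, psum ℂ #{x | π x = i}).1 =
      Nat.card {f : α → ℕ // (∃ g : ι → ℕ, f = g ∘ π) ∧
        univ.val.map f = Finsupp.toMultiset d} := by
  -- Surjectivity matters here: for an empty fibre the exponent would be zero, and `Finsupp.single j
  -- 0` forgets `j`.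
  have hsize : ∀ i, #{x | π x = i} ≠ 0 := fun i => by
    obtain ⟨x, hx⟩ := hπ i
    exact (Finset.card_pos.2 ⟨x, by simpa using hx⟩).ne'
  have hsum : ∀ g : ι → ℕ, ∑ x, Finsupp.single (g (π x)) 1 =
      ∑ i, Finsupp.single (g i) #{x | π x = i} := by
    intro g
    rw [← Finset.sum_fiberwise univ π]
    refine Finset.sum_congr rfl fun i _ => ?_
    rw [Finset.sum_congr rfl (g := fun _ => Finsupp.single (g i) 1)
      (fun x hx => by rw [(Finset.mem_filter.1 hx).2]), Finset.sum_const, Finsupp.smul_single,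
      smul_eq_mul, mul_one]
  rw [coeff_prod_indicator _ (fun i e => ∃ j, e = Finsupp.single j #{x | π x = i})
    (fun i e => by rfl)]
  congr 1
  trans Nat.card {g : ι → ℕ // ∑ i, Finsupp.single (g i) #{x | π x = i} = d}
  · symm
    refine Nat.card_eq_of_bijective
      (fun g => ⟨fun i => Finsupp.single (g.1 i) #{x | π x = i}, fun i => ⟨_, rfl⟩, g.2⟩) ⟨?_, ?_⟩
    · intro g g' h
      apply Subtype.ext
      funext i
      have := congrFun (congrArg Subtype.val h) i
      exact Finsupp.single_left_injective (hsize i) this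
    · rintro ⟨l, hl, hd⟩
      have hl' := hl
      choose g hg using hl'
      refine ⟨⟨g, ?_⟩, Subtype.ext (funext fun i => (hg i).symm)⟩
      rw [← hd]
      exact Finset.sum_congr rfl fun i _ => (hg i).symm
  · refine Nat.card_eq_of_bijective
      (fun g => ⟨g.1 ∘ π, ⟨g.1, rfl⟩, ?_⟩) ⟨?_, ?_⟩
    · rw [map_univ_eq_toMultiset_iff]
      exact (hsum g.1).trans g.2
    · intro g g' h
      exact Subtype.ext (hπ.injective_comp_right (congrArg Subtype.val h))
    · rintro ⟨f, ⟨g, rfl⟩, hf⟩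
      refine ⟨⟨g, ?_⟩, rfl⟩
      rw [map_univ_eq_toMultiset_iff] at hf
      rw [← hsum]
      exact hf

end Coefficients

/-! ### Power sums of cycle types and words invariant under a permutation -/

section CycleType

variable {n : ℕ}

/-- The cycle of a permutation through a given point, or the point if it is fixed. -/
def cycleClass (σ : Equiv.Perm (Fin n)) (x : Fin n) :
    {c // c ∈ σ.cycleFactorsFinset} ⊕ {x // x ∉ σ.support} :=
  if h : x ∈ σ.support then
    Sum.inl ⟨σ.cycleOf x, Equiv.Perm.cycleOf_mem_cycleFactorsFinset_iff.2 h⟩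
  else Sum.inr ⟨x, h⟩

theorem cycleClass_eq_inl_iff (σ : Equiv.Perm (Fin n)) (x : Fin n)
    (c : {c // c ∈ σ.cycleFactorsFinset}) : cycleClass σ x = Sum.inl c ↔ x ∈ c.1.support := by
  have h1 := Equiv.Perm.eq_cycleOf_of_mem_cycleFactorsFinset_iff σ c.1 c.2 x
  have h2 := @Equiv.Perm.mem_cycleFactorsFinset_support_le _ _ _ c.1 σ c.2 x
  rw [← h1, cycleClass]
  split_ifs with h
  · rw [Sum.inl.injEq, Subtype.ext_iff]
    exact eq_comm
  · simp only [false_iff]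
    intro h3
    exact h (h2 (h1.1 h3))

theorem cycleClass_eq_inr_iff (σ : Equiv.Perm (Fin n)) (x : Fin n)
    (y : {x // x ∉ σ.support}) : cycleClass σ x = Sum.inr y ↔ x = y := by
  rw [cycleClass]
  split_ifs with h
  · simp only [false_iff]
    rintro rfl
    exact y.2 h
  · rw [Sum.inr.injEq, Subtype.ext_iff]

theorem cycleClass_surjective (σ : Equiv.Perm (Fin n)) : Function.Surjective (cycleClass σ) := by
  rintro (c | y)
  · obtain ⟨x, hx⟩ := (Equiv.Perm.mem_cycleFactorsFinset_iff.1 c.2).1.nonempty_support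
    exact ⟨x, (cycleClass_eq_inl_iff σ x c).2 hx⟩
  · exact ⟨y, (cycleClass_eq_inr_iff σ y y).2 rfl⟩

theorem cycleClass_apply (σ : Equiv.Perm (Fin n)) (x : Fin n) :
    cycleClass σ (σ x) = cycleClass σ x := by
  rcases h : cycleClass σ x with c | y
  · rw [cycleClass_eq_inl_iff] at h ⊢
    rw [← (Equiv.Perm.mem_cycleFactorsFinset_iff.1 c.2).2 x h]
    exact Equiv.Perm.apply_mem_support.2 h
  · rw [cycleClass_eq_inr_iff] at h ⊢
    rw [h]
    exact Equiv.Perm.notMem_support.1 y.2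

theorem sameCycle_of_cycleClass_eq (σ : Equiv.Perm (Fin n)) {x y : Fin n}
    (h : cycleClass σ x = cycleClass σ y) : σ.SameCycle x y := by
  rcases hy : cycleClass σ y with c | z
  · rw [hy] at h
    have h' := h
    rw [cycleClass_eq_inl_iff] at h hy
    rw [Equiv.Perm.sameCycle_iff_cycleOf_eq_of_mem_support
      (Equiv.Perm.mem_cycleFactorsFinset_support_le c.2 h)
      (Equiv.Perm.mem_cycleFactorsFinset_support_le c.2 hy),
      ← Equiv.Perm.cycle_is_cycleOf h c.2, ← Equiv.Perm.cycle_is_cycleOf hy c.2]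
  · rw [hy, cycleClass_eq_inr_iff] at h
    rw [cycleClass_eq_inr_iff] at hy
    rw [h, hy]

/-- The fibres of `cycleClass σ` are the cycles of `σ`, fixed points included, and an invariant word
is one that is constant on cycles. -/
theorem invariant_iff_factors_cycleClass (σ : Equiv.Perm (Fin n)) (f : Fin n → ℕ) :
    (∃ g, f = g ∘ cycleClass σ) ↔ f ∘ σ = f := by
  constructor
  · rintro ⟨g, rfl⟩
    funext x
    simp only [Function.comp_apply, cycleClass_apply]
  · intro h
    refine ⟨fun i => f (Function.surjInv (cycleClass_surjective σ) i), funext fun x => ?_⟩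
    have hs := sameCycle_of_cycleClass_eq σ
      (Function.surjInv_eq (cycleClass_surjective σ) (cycleClass σ x))
    obtain ⟨k, hk⟩ := hs.symm.exists_nat_pow_eq
    simp only [Function.comp_apply]
    rw [← hk]
    clear hk hs
    induction k with
    | zero => rfl
    | succ k ih => rw [ih, pow_succ', Equiv.Perm.mul_apply, ← congrFun h, Function.comp_apply]

/-- The fibres over `Sum.inl` are the supports of the nontrivial cycles and those over `Sum.inr` are
singletons. This matches the splitting of `σ.partition` into `σ.cycleType` and parts equal to one,
and puts the product in the form needed for `coeff_prod_psum_fiber`. -/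
theorem psumPart_partition (σ : Equiv.Perm (Fin n)) :
    psumPart ℂ σ.partition = ∏ i, psum ℂ #{x | cycleClass σ x = i} := by
  rw [Fintype.prod_sum_type]
  simp only [cycleClass_eq_inl_iff, cycleClass_eq_inr_iff]
  rw [psumPart, Equiv.Perm.partition]
  simp only [Multiset.map_add, Multiset.prod_add, Multiset.map_replicate, Multiset.prod_replicate]
  congr 1
  · rw [Equiv.Perm.cycleType_def, Multiset.map_map, Finset.prod_coe_sort σ.cycleFactorsFinset
      (fun c => psum ℂ #{x | x ∈ c.support})]
    exact Finset.prod_congr rfl fun c _ => by rw [Finset.filter_univ_mem]; rfl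
  · simp only [Finset.filter_eq', Finset.mem_univ, if_true, Finset.card_singleton,
      Finset.prod_const, Finset.card_univ]
    congr 1
    rw [Fintype.card_subtype_compl, Fintype.card_coe]

theorem coeff_psumPart_partition (σ : Equiv.Perm (Fin n)) (d : ℕ →₀ ℕ) :
    MvPowerSeries.coeff d (psumPart ℂ σ.partition).1 =
      Nat.card {f : Fin n → ℕ // f ∘ σ = f ∧ univ.val.map f = Finsupp.toMultiset d} := by
  rw [psumPart_partition, coeff_prod_psum_fiber _ (cycleClass_surjective σ)]
  simp only [invariant_iff_factors_cycleClass]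

end CycleType

/-! ### Products of `h_k` and of `e_k` as counts of matrices -/

section Matrices

variable {L : Type*} [DecidableEq L]

/-- The multisets of pairs with given marginals, that is, the nonnegative integer matrices with
given row and column sums. -/
def marginals (d : ℕ →₀ ℕ) (M : Multiset L) : Set (Multiset (ℕ × L)) :=
  {m | m.map Prod.fst = Finsupp.toMultiset d ∧ m.map Prod.snd = M}

/-- The product of the `h_k`, for `k` the multiplicities of the elements of `M`. -/
def completeMult (M : Multiset L) : SymmFun ℂ := ∏ a ∈ M.toFinset, complete ℂ (M.count a)

/-- The product of the `e_k`, for `k` the multiplicities of the elements of `M`. -/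
def elemMult (M : Multiset L) : SymmFun ℂ := ∏ a ∈ M.toFinset, elem ℂ (M.count a)

/-- The row of a matrix at `a`. -/
def matrixRow (m : Multiset (ℕ × L)) (a : L) : ℕ →₀ ℕ :=
  Multiset.toFinsupp ((m.filter fun x => x.2 = a).map Prod.fst)

theorem matrixRow_apply (m : Multiset (ℕ × L)) (a : L) (i : ℕ) :
    matrixRow m a i = m.count (i, a) := by
  rw [matrixRow, Multiset.toFinsupp_apply, Multiset.count_map, Multiset.filter_filter,
    ← Multiset.countP_eq_card_filter, Multiset.count]
  refine Multiset.countP_congr rfl fun x _ => ?_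
  rw [Prod.ext_iff, eq_comm (a := i), eq_comm (a := a)]

theorem degree_matrixRow (m : Multiset (ℕ × L)) (a : L) :
    (matrixRow m a).degree = (m.map Prod.snd).count a := by
  have h : (matrixRow m a).degree = (matrixRow m a).sum fun _ => id := rfl
  rw [h, matrixRow, Multiset.toFinsupp_sum_eq, Multiset.card_map, Multiset.count_map]
  simp only [eq_comm]

theorem sum_matrixRow (m : Multiset (ℕ × L)) (s : Finset L) (hs : (m.map Prod.snd).toFinset ⊆ s) :
    ∑ a ∈ s, matrixRow m a = Multiset.toFinsupp (m.map Prod.fst) := by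
  induction m using Multiset.induction with
  | empty => simp [matrixRow]
  | cons x m ih =>
    have hcons : ∀ a, matrixRow (x ::ₘ m) a =
        (if x.2 = a then Finsupp.single x.1 1 else 0) + matrixRow m a := by
      intro a
      rw [matrixRow, Multiset.filter_cons, Multiset.map_add, map_add, matrixRow]
      split_ifs <;> simp
    rw [Multiset.map_cons, Multiset.toFinset_cons, Finset.insert_subset_iff] at hs
    simp only [hcons, Finset.sum_add_distrib, Finset.sum_ite_eq, if_pos hs.1, ih hs.2]
    rw [Multiset.map_cons, ← Multiset.singleton_add, map_add, Multiset.toFinsupp_singleton]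

/-- Choosing the rows of a matrix. -/
theorem card_rows_eq_card_marginals (d : ℕ →₀ ℕ) (M : Multiset L) (p : (ℕ →₀ ℕ) → Prop) :
    Nat.card {l : M.toFinset → ℕ →₀ ℕ //
      (∀ a, (l a).degree = M.count a.1 ∧ p (l a)) ∧ ∑ a, l a = d} =
    Nat.card {m : Multiset (ℕ × L) // m ∈ marginals d M ∧ ∀ a ∈ M.toFinset, p (matrixRow m a)} := by
  symm
  refine Nat.card_eq_of_bijective (fun m => ⟨fun a => matrixRow m.1 a, fun a => ⟨?_, ?_⟩, ?_⟩)
    ⟨?_, ?_⟩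
  · rw [degree_matrixRow, m.2.1.2]
  · exact m.2.2 a a.2
  · rw [Finset.sum_coe_sort M.toFinset (matrixRow m.1), sum_matrixRow, m.2.1.1,
      Finsupp.toMultiset_toFinsupp]
    rw [m.2.1.2]
  · rintro ⟨m, hm, hp⟩ ⟨m', hm', hp'⟩ h
    apply Subtype.ext
    ext ⟨i, a⟩
    by_cases ha : a ∈ M.toFinset
    · have h1 := congrFun (congrArg Subtype.val h) ⟨a, ha⟩
      rw [← matrixRow_apply, ← matrixRow_apply]
      exact DFunLike.congr_fun h1 i
    · have key : ∀ m ∈ marginals d M, m.count (i, a) = 0 := by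
        intro m hm
        rw [Multiset.count_eq_zero]
        intro h'
        apply ha
        rw [Multiset.mem_toFinset, ← hm.2]
        exact Multiset.mem_map_of_mem Prod.snd h'
      rw [key m hm, key m' hm']
  · rintro ⟨l, hl, hd⟩
    -- The matrix is reassembled by tagging the entries of each row with the label of the row.
    let m : Multiset (ℕ × L) := ∑ a, (Finsupp.toMultiset (l a)).map fun i => (i, a.1)
    have hcount : ∀ (a : M.toFinset), matrixRow m a = l a := by
      intro a
      ext i
      rw [matrixRow_apply, Multiset.count_sum', Finset.sum_eq_single a]
      · rw [Multiset.count_map_eq_count' _ _ (Prod.mk_left_injective a.1), Finsupp.count_toMultiset]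
      · intro b _ hb
        rw [Multiset.count_eq_zero, Multiset.mem_map]
        rintro ⟨j, -, hj⟩
        exact hb (Subtype.ext (congrArg Prod.snd hj))
      · simp
    have hfst : m.map Prod.fst = Finsupp.toMultiset d := by
      rw [← hd, map_sum, ← Multiset.coe_mapAddMonoidHom, map_sum]
      simp
    have hsnd : m.map Prod.snd = M := by
      rw [← Multiset.toFinset_sum_count_nsmul_eq M, ← Multiset.coe_mapAddMonoidHom, map_sum,
        ← Finset.sum_coe_sort M.toFinset]
      refine Finset.sum_congr rfl fun a _ => ?_
      rw [Multiset.coe_mapAddMonoidHom, Multiset.map_map, Function.comp_def, Multiset.map_const',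
        ← (hl a).1, Multiset.nsmul_singleton, Finsupp.card_toMultiset]
      rfl
    refine ⟨⟨m, ⟨hfst, hsnd⟩, fun a ha => ?_⟩, Subtype.ext (funext hcount)⟩
    rw [hcount ⟨a, ha⟩]
    exact (hl ⟨a, ha⟩).2

theorem coeff_completeMult (d : ℕ →₀ ℕ) (M : Multiset L) :
    MvPowerSeries.coeff d (completeMult M).1 = (marginals d M).ncard := by
  rw [completeMult, ← Finset.prod_coe_sort,
    coeff_prod_indicator _ (fun i e => e.degree = M.count i.1)
      (fun i e => by change @ite _ _ _ _ _ = _; congr)]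
  have := card_rows_eq_card_marginals d M (fun _ => True)
  simp only [and_true, implies_true] at this
  rw [this]
  rfl

/-- A factor `e_k` contributes a row of zeros and ones with sum `k`, and a matrix has only such rows
exactly when no pair is repeated. -/
theorem coeff_elemMult (d : ℕ →₀ ℕ) (M : Multiset L) :
    MvPowerSeries.coeff d (elemMult M).1 = {m ∈ marginals d M | m.Nodup}.ncard := by
  rw [elemMult, ← Finset.prod_coe_sort,
    coeff_prod_indicator _ (fun i e => e.degree = M.count i.1 ∧ ∀ j, e j ≤ 1)
      (fun i e => by classical change @ite _ _ _ _ _ = _; congr)]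
  rw [card_rows_eq_card_marginals d M (fun e => ∀ j, e j ≤ 1)]
  congr 1
  refine Nat.card_congr (Equiv.subtypeEquivRight fun m => and_congr_right fun hm => ?_)
  simp only [matrixRow_apply, Multiset.nodup_iff_count_le_one]
  refine ⟨fun h ⟨j, a⟩ => ?_, fun h a _ j => h _⟩
  by_cases ha : a ∈ M.toFinset
  · exact h a ha j
  · rw [Multiset.count_eq_zero.2]
    · exact zero_le_one
    · intro h'
      apply ha
      rw [Multiset.mem_toFinset, ← hm.2]
      exact Multiset.mem_map_of_mem Prod.snd h'

/-- The multiplicities of the elements of a multiset. -/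
def multiplicities {n : ℕ} (M : Multiset L) (hM : M.card = n) : n.Partition where
  parts := M.toFinset.val.map M.count
  parts_pos := by
    intro i hi
    obtain ⟨a, ha, rfl⟩ := Multiset.mem_map.1 hi
    exact Multiset.count_pos.2 (Multiset.mem_toFinset.1 ha)
  parts_sum := by
    rw [← hM, ← Multiset.toFinset_sum_count_eq]
    rfl

theorem completePart_multiplicities {n : ℕ} (M : Multiset L) (hM : M.card = n) :
    completePart ℂ (multiplicities M hM) = completeMult M := by
  rw [completePart, multiplicities, Multiset.map_map]
  rfl

theorem elemPart_multiplicities {n : ℕ} (M : Multiset L) (hM : M.card = n) :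
    elemPart ℂ (multiplicities M hM) = elemMult M := by
  rw [elemPart, multiplicities, Multiset.map_map]
  rfl

theorem omega_elemMult (M : Multiset L) : omega ℂ (elemMult M) = completeMult M := by
  simp only [elemMult, completeMult, map_prod, omega_elem]

end Matrices

/-! ### Words, their contents and their sorted rearrangements -/

section Tuples

variable {n : ℕ} {α : Type*} [LinearOrder α]

theorem _root_.Monotone.eq_of_map_univ_eq {f g : Fin n → α} (hf : Monotone f) (hg : Monotone g)
    (h : univ.val.map f = univ.val.map g) : f = g := by
  rw [Fin.univ_val_map, Fin.univ_val_map, Multiset.coe_eq_coe] at h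
  exact List.ofFn_injective (h.eq_of_pairwise' hf.sortedLE_ofFn.pairwise hg.sortedLE_ofFn.pairwise)

theorem map_univ_comp_perm {β : Type*} (f : Fin n → β) (σ : Equiv.Perm (Fin n)) :
    univ.val.map (f ∘ σ) = univ.val.map f := by
  rw [← Multiset.map_map, Multiset.map_univ_val_equiv]

theorem exists_eq_comp_perm_of_map_univ_eq {f g : Fin n → α}
    (h : univ.val.map f = univ.val.map g) : ∃ σ : Equiv.Perm (Fin n), g = f ∘ σ := by
  have h1 : f ∘ Tuple.sort f = g ∘ Tuple.sort g :=
    (Tuple.monotone_sort f).eq_of_map_univ_eq (Tuple.monotone_sort g) (by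
      rw [map_univ_comp_perm, map_univ_comp_perm, h])
  refine ⟨(Tuple.sort g).symm.trans (Tuple.sort f), funext fun i => ?_⟩
  have := congrFun h1 ((Tuple.sort g).symm i)
  simpa using this.symm

theorem exists_monotone_map_univ_eq (m : Multiset α) (hm : m.card = n) :
    ∃ f : Fin n → α, Monotone f ∧ univ.val.map f = m := by
  subst hm
  refine ⟨fun i => m.sort.get (i.cast (Multiset.length_sort _).symm), ?_, ?_⟩
  · exact (Multiset.pairwise_sort m (· ≤ ·)).sortedLE.monotone_get.comp (Fin.cast_strictMono _).monotone
  · rw [Fin.univ_val_map]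
    conv_rhs => rw [← Multiset.sort_eq m (· ≤ ·)]
    congr 1
    apply List.ext_get (by simp)
    intro i h1 h2
    simp

end Tuples

/-! ### Burnside's lemma for words -/

section Burnside

variable {n : ℕ} {α : Type*}

theorem finite_setOf_map_univ_mem {T : Set (Multiset α)} (hT : T.Finite) :
    {g : Fin n → α | univ.val.map g ∈ T}.Finite := by
  classical
  have hfin : (⋃ m ∈ T, (m.toFinset : Set α)).Finite := hT.biUnion fun m _ => m.toFinset.finite_toSet
  refine (Set.Finite.pi (ι := Fin n) fun _ => hfin).subset fun g hg i _ => ?_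
  refine Set.mem_biUnion hg ?_
  simp

/-- Burnside's lemma for the tuples whose multiset of entries lies in a given set. -/
theorem sum_card_fixed_tuples [LinearOrder α] {T : Set (Multiset α)} (hT : T.Finite)
    (hc : ∀ m ∈ T, m.card = n) :
    ∑ σ : Equiv.Perm (Fin n), Nat.card {g : Fin n → α // g ∘ σ = g ∧ univ.val.map g ∈ T} =
      T.ncard * n.factorial := by
  classical
  let X := {g : Fin n → α // univ.val.map g ∈ T}
  let act : MulAction (Equiv.Perm (Fin n)) X :=
    { smul := fun σ g => ⟨g.1 ∘ ⇑σ⁻¹, by rw [map_univ_comp_perm]; exact g.2⟩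
      one_smul := fun g => rfl
      mul_smul := fun σ τ g => Subtype.ext (by
        change g.1 ∘ ⇑(σ * τ)⁻¹ = (g.1 ∘ ⇑τ⁻¹) ∘ ⇑σ⁻¹
        rw [mul_inv_rev]
        rfl) }
  have hsmul : ∀ (σ : Equiv.Perm (Fin n)) (g : X), (σ • g).1 = g.1 ∘ ⇑σ⁻¹ := fun _ _ => rfl
  have : Finite X := (finite_setOf_map_univ_mem (n := n) hT).to_subtype
  let _ : Fintype X := Fintype.ofFinite X
  have hB := MulAction.sum_card_fixedBy_eq_card_orbits_mul_card_group (Equiv.Perm (Fin n)) X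
  rw [Fintype.card_perm, Fintype.card_fin, ← Nat.card_eq_fintype_card] at hB
  -- Two words lie in one orbit exactly when they have the same content, so orbits correspond to the
  -- multisets in `T`.
  have h1 : Nat.card (MulAction.orbitRel.Quotient (Equiv.Perm (Fin n)) X) = T.ncard := by
    refine Nat.card_eq_of_bijective (β := T)
      (Quotient.lift (fun g : X => ⟨univ.val.map g.1, g.2⟩) ?_) ⟨?_, ?_⟩
    · rintro _ g ⟨σ, rfl⟩
      exact Subtype.ext (map_univ_comp_perm _ _)
    · rintro ⟨g⟩ ⟨g'⟩ h
      obtain ⟨σ, hσ⟩ := exists_eq_comp_perm_of_map_univ_eq (congrArg Subtype.val h)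
      refine Quotient.sound ⟨σ, Subtype.ext ?_⟩
      change g'.1 ∘ ⇑σ⁻¹ = g.1
      rw [hσ, Function.comp_assoc]
      funext i
      simp
    · rintro ⟨m, hm⟩
      obtain ⟨g, -, hg⟩ := exists_monotone_map_univ_eq m (hc m hm)
      exact ⟨Quotient.mk _ ⟨g, by rw [hg]; exact hm⟩, Subtype.ext hg⟩
  rw [← h1, ← hB]
  refine Finset.sum_congr rfl fun σ _ => ?_
  rw [← Nat.card_eq_fintype_card]
  refine Nat.card_eq_of_bijective (fun g => ⟨⟨g.1, g.2.2⟩, ?_⟩) ⟨?_, ?_⟩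
  · refine Subtype.ext ?_
    rw [hsmul]
    conv_lhs => rw [← g.2.1]
    funext i
    simp
  · intro g g' h
    exact Subtype.ext (congrArg (fun x => x.1.1) h)
  · rintro ⟨g, hg⟩
    refine ⟨⟨g.1, ?_, g.2⟩, rfl⟩
    have : g.1 ∘ ⇑σ⁻¹ = g.1 := congrArg Subtype.val hg
    conv_lhs => rw [← this]
    funext i
    simp

end Burnside

/-! ### The Frobenius characteristic of the chain representation -/

section Character

/-- In the basis `H` the matrix of `g` is a permutation matrix, whose trace counts fixed points. -/
theorem character_ofMulAction {G H : Type*} [Group G] [MulAction G H] [Finite H] (g : G) :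
    (Representation.ofMulAction ℂ G H).character g = Nat.card {x : H // g • x = x} := by
  classical
  have := Fintype.ofFinite H
  let b : Module.Basis H ℂ (MonoidAlgebra ℂ H) := .ofRepr (MonoidAlgebra.coeffLinearEquiv ℂ)
  rw [Representation.character, LinearMap.trace_eq_matrix_trace ℂ b, Matrix.trace]
  simp only [Matrix.diag_apply, LinearMap.toMatrix_apply]
  have : ∀ x : H, b.repr ((Representation.ofMulAction ℂ G H g) (b x)) x =
      if g • x = x then 1 else 0 := by
    intro x
    have h1 : b x = MonoidAlgebra.single x 1 := rfl
    rw [h1, Representation.ofMulAction_single]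
    exact Finsupp.single_apply
  simp only [this]
  rw [Finset.sum_boole, Nat.card_eq_fintype_card, Fintype.card_subtype]

variable {P : Type*} [PartialOrder P] [BoundedOrder P] {n : ℕ} {L : Type*}

instance [Finite P] : Finite (MaxChain P n) :=
  Finite.of_injective MaxChain.elt fun _ _ h => MaxChain.ext h

theorem IsSLabeling.chainCharacter_eq [Finite P] {Λ : MaxChain P n → Fin n → L}
    (hS : IsSLabeling Λ) (σ : Equiv.Perm (Fin n)) :
    hS.chainCharacter σ = Nat.card {c : MaxChain P n // Λ c ∘ σ = Λ c} := by
  let _ := hS.action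
  rw [IsSLabeling.chainCharacter, character_ofMulAction]
  congr 1
  refine Nat.card_congr (Equiv.subtypeEquivRight fun c => ?_)
  rw [← hS.1.eq_iff]
  have h : Λ (σ • c) = Λ c ∘ ⇑σ⁻¹ := hS.label_smul σ c
  rw [h]
  constructor <;> intro h'
  · conv_lhs => rw [← h']
    funext i
    simp
  · conv_lhs => rw [← h']
    funext i
    simp

/-- The multisets of labels of the maximal chains. -/
def labelMultisets [Finite P] (Λ : MaxChain P n → Fin n → L) : Finset (Multiset L) :=
  (Set.finite_range fun c => univ.val.map (Λ c)).toFinset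

theorem mem_labelMultisets [Finite P] {Λ : MaxChain P n → Fin n → L} {M : Multiset L} :
    M ∈ labelMultisets Λ ↔ ∃ c, univ.val.map (Λ c) = M := by
  simp [labelMultisets]

theorem card_of_mem_labelMultisets [Finite P] {Λ : MaxChain P n → Fin n → L} {M : Multiset L}
    (hM : M ∈ labelMultisets Λ) : M.card = n := by
  obtain ⟨c, rfl⟩ := mem_labelMultisets.1 hM
  simp

theorem finite_marginals [DecidableEq L] (d : ℕ →₀ ℕ) (M : Multiset L) : (marginals d M).Finite := by
  -- Every pair that occurs lies in `d.support ×ˢ M.toFinset`, with multiplicity at most the total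
  -- `M.card`.
  refine (Set.finite_Iic (M.card • (d.support ×ˢ M.toFinset).val)).subset fun m hm => ?_
  rw [Set.mem_Iic, Multiset.le_iff_count]
  rintro ⟨i, a⟩
  by_cases h : (i, a) ∈ m
  · have h1 : (i, a) ∈ d.support ×ˢ M.toFinset := by
      rw [Finset.mem_product, Multiset.mem_toFinset, ← Finsupp.mem_toMultiset, ← hm.1, ← hm.2]
      exact ⟨Multiset.mem_map_of_mem _ h, Multiset.mem_map_of_mem _ h⟩
    rw [Multiset.count_nsmul, Multiset.count_eq_one_of_mem (Finset.nodup _) h1, mul_one,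
      ← hm.2, Multiset.card_map]
    exact Multiset.count_le_card _ _
  · rw [Multiset.count_eq_zero.2 h]
    exact Nat.zero_le _

/-- The sets `marginals d M` are disjoint for different `M`, because `M` is recovered as the second
marginal. The set `q` is specialized to all matrices in the R case and to the matrices without
repeated pairs in the R* case. -/
theorem ncard_biUnion_of_subset_marginals [DecidableEq L] (d : ℕ →₀ ℕ) (s : Finset (Multiset L))
    (q : Set (Multiset (ℕ × L))) :
    {m ∈ q | ∃ M ∈ s, m ∈ marginals d M}.ncard = ∑ M ∈ s, {m ∈ marginals d M | m ∈ q}.ncard := by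
  classical
  have hfin : ∀ M, {m ∈ marginals d M | m ∈ q}.Finite := fun M =>
    (finite_marginals d M).subset (Set.sep_subset _ _)
  have h : {m ∈ q | ∃ M ∈ s, m ∈ marginals d M} = (s.biUnion fun M => (hfin M).toFinset) := by
    ext m
    simp only [Set.mem_ofPred_eq, Finset.mem_coe, Finset.mem_biUnion, Set.Finite.mem_toFinset]
    tauto
  rw [h, Set.ncard_coe_finset, Finset.card_biUnion]
  · exact Finset.sum_congr rfl fun M _ => (Set.ncard_eq_toFinset_card _ _).symm
  · intro M _ M' _ hne
    rw [Function.onFun, Finset.disjoint_left]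
    intro m h1 h2
    rw [Set.Finite.mem_toFinset] at h1 h2
    exact hne (h1.1.2.symm.trans h2.1.2)

theorem coeff_sum {ι : Type*} (d : ℕ →₀ ℕ) (s : Finset ι) (f : ι → SymmFun ℂ) :
    MvPowerSeries.coeff d (∑ i ∈ s, f i).1 = ∑ i ∈ s, MvPowerSeries.coeff d (f i).1 := by
  rw [← map_sum]
  congr 1
  exact map_sum (SymmFun ℂ).val f s

/-- The Frobenius characteristic is a sum of products of complete homogeneous symmetric functions,
one for each orbit. -/
theorem IsSLabeling.frobeniusChar_chainCharacter [Finite P] [LinearOrder L]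
    {Λ : MaxChain P n → Fin n → L} (hS : IsSLabeling Λ) :
    frobeniusChar hS.chainCharacter = ∑ M ∈ labelMultisets Λ, completeMult M := by
  apply Subtype.ext
  ext d
  let T : Set (Multiset (ℕ × L)) := {m | ∃ M ∈ labelMultisets Λ, m ∈ marginals d M}
  have hT : T.ncard = ∑ M ∈ labelMultisets Λ, (marginals d M).ncard := by
    have := ncard_biUnion_of_subset_marginals d (labelMultisets Λ) Set.univ
    simpa using this
  have hTfin : T.Finite := by
    have : T = ⋃ M ∈ (labelMultisets Λ : Set (Multiset L)), marginals d M := by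
      ext m
      simp [T]
    rw [this]
    exact (labelMultisets Λ).finite_toSet.biUnion fun M _ => finite_marginals d M
  have hTcard : ∀ m ∈ T, m.card = n := by
    rintro m ⟨M, hM, hm⟩
    rw [← Multiset.card_map Prod.snd, hm.2, card_of_mem_labelMultisets hM]
  -- An invariant word of pairs is a pair of invariant words. The second component comes from a
  -- chain because its content is the content of some label word, and label words are closed under
  -- rearrangement; the chain is unique because `Λ` is injective.
  have hprod : ∀ σ : Equiv.Perm (Fin n),
      Nat.card {c : MaxChain P n // Λ c ∘ σ = Λ c} *
        Nat.card {f : Fin n → ℕ // f ∘ σ = f ∧ univ.val.map f = Finsupp.toMultiset d} =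
      Nat.card {g : Fin n → ℕ × L // g ∘ σ = g ∧ univ.val.map g ∈ T} := by
    intro σ
    rw [← Nat.card_prod]
    refine Nat.card_eq_of_bijective (fun x => ⟨fun i => (x.2.1 i, Λ x.1.1 i), ?_, ?_⟩) ⟨?_, ?_⟩
    · funext i
      exact Prod.ext (congrFun x.2.2.1 i) (congrFun x.1.2 i)
    · refine ⟨_, mem_labelMultisets.2 ⟨x.1.1, rfl⟩, ?_, ?_⟩
      · rw [Multiset.map_map]
        exact x.2.2.2
      · rw [Multiset.map_map]
        rfl
    · intro x y h
      have h1 := congrArg Subtype.val h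
      refine Prod.ext (Subtype.ext (hS.1 (funext fun i => ?_))) (Subtype.ext (funext fun i => ?_))
      · exact congrArg Prod.snd (congrFun h1 i)
      · exact congrArg Prod.fst (congrFun h1 i)
    · rintro ⟨g, hg, M, hM, h1, h2⟩
      obtain ⟨c, rfl⟩ := mem_labelMultisets.1 hM
      rw [Multiset.map_map] at h1 h2
      obtain ⟨τ, hτ⟩ := exists_eq_comp_perm_of_map_univ_eq h2.symm
      obtain ⟨c', hc'⟩ := hS.exists_eq_comp τ c
      have h3 : Λ c' = Prod.snd ∘ g := hc'.trans hτ.symm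
      refine ⟨⟨⟨c', ?_⟩, ⟨Prod.fst ∘ g, ?_, h1⟩⟩, Subtype.ext (funext fun i => ?_)⟩
      · rw [h3, Function.comp_assoc, hg]
      · rw [Function.comp_assoc, hg]
      · exact Prod.ext rfl (congrFun h3 i)
  have hB : ∑ σ : Equiv.Perm (Fin n),
      Nat.card {g : Fin n → ℕ × L // g ∘ σ = g ∧ univ.val.map g ∈ T} = T.ncard * n.factorial :=
    -- The Burnside count needs some linear order on the letters; the lexicographic product provides
    -- one on the same underlying pairs.
    sum_card_fixed_tuples (α := ℕ ×ₗ L) (T := T) hTfin hTcard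
  have hcoe : ∀ (a : ℂ) (f : SymmFun ℂ), MvPowerSeries.coeff d (a • f).1 =
    a * MvPowerSeries.coeff d f.1 := fun a f => rfl
  rw [frobeniusChar, hcoe, coeff_sum, coeff_sum]
  simp only [hcoe, hS.chainCharacter_eq, coeff_psumPart_partition, coeff_completeMult]
  have hfac : (n.factorial : ℂ) ≠ 0 := Nat.cast_ne_zero.2 n.factorial_ne_zero
  rw [inv_mul_eq_iff_eq_mul₀ hfac]
  norm_cast
  rw [Finset.sum_congr rfl fun σ _ => hprod σ, hB, hT, mul_comm]

end Character

/-! ### Maximal chains through given elements -/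

section Chains

variable {P : Type*} [PartialOrder P] [BoundedOrder P] {n : ℕ}

theorem MaxChain.strictMono (c : MaxChain P n) : StrictMono c.elt :=
  Fin.strictMono_iff_lt_succ.2 fun i => (c.covBy i).lt

theorem MaxChain.grade_elt [GradeMinOrder ℕ P] (c : MaxChain P n) (i : Fin (n + 1)) :
    grade ℕ (c.elt i) = i := by
  induction i using Fin.induction with
  | zero =>
    rw [c.bot_eq, grade_bot]
    rfl
  | succ i ih =>
    have h := Nat.covBy_iff_add_one_eq.1 ((c.covBy i).grade ℕ)
    rw [← h, ih]
    simp

/-- The element of rank `k`; the last element if `k` exceeds the length. -/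
def MaxChain.nth (c : MaxChain P n) (k : ℕ) : P := c.elt ⟨min k n, by omega⟩

theorem MaxChain.nth_eq (c : MaxChain P n) {k : ℕ} (hk : k ≤ n) :
    c.nth k = c.elt ⟨k, Nat.lt_succ_of_le hk⟩ := by
  simp only [nth, min_eq_left hk]

theorem MaxChain.nth_monotone (c : MaxChain P n) : Monotone c.nth := fun _ _ hij =>
  c.strictMono.monotone (Fin.mk_le_mk.2 (min_le_min_right n hij))

theorem MaxChain.grade_nth [GradeMinOrder ℕ P] (c : MaxChain P n) {k : ℕ} (hk : k ≤ n) :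
    grade ℕ (c.nth k) = k := by
  rw [c.nth_eq hk, c.grade_elt]

theorem eq_of_le_of_grade_eq [GradeMinOrder ℕ P] {x y : P} (h : x ≤ y)
    (hg : grade ℕ x = grade ℕ y) : x = y := by
  by_contra hne
  have := (grade_strictMono (𝕆 := ℕ) (lt_of_le_of_ne h hne))
  omega

theorem exists_saturated [Finite P] [GradeMinOrder ℕ P] (k : ℕ) (x y : P) (hxy : x ≤ y)
    (hk : grade ℕ y = grade ℕ x + k) :
    ∃ w : ℕ → P, w 0 = x ∧ w k = y ∧ ∀ i < k, w i ⋖ w (i + 1) := by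
  induction k generalizing x with
  | zero => exact ⟨fun _ => x, rfl, eq_of_le_of_grade_eq hxy hk.symm, by simp⟩
  | succ k ih =>
    have hlt : x < y := lt_of_le_of_ne hxy (by rintro rfl; omega)
    obtain ⟨z, hz, hzy⟩ := exists_covBy_le_of_lt hlt
    have h := Nat.covBy_iff_add_one_eq.1 (hz.grade ℕ)
    obtain ⟨w, h0, h1, hw⟩ := ih z hzy (by omega)
    refine ⟨fun i => if i = 0 then x else w (i - 1), by simp, by simpa using h1, fun i hi => ?_⟩
    rcases i with _ | i
    · simpa [h0] using hz
    · simpa using hw i (by omega)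

theorem exists_saturated_trans {x y z : P} {k l : ℕ} {w w' : ℕ → P} (h0 : w 0 = x) (h1 : w k = y)
    (hw : ∀ i < k, w i ⋖ w (i + 1)) (h0' : w' 0 = y) (h1' : w' l = z)
    (hw' : ∀ i < l, w' i ⋖ w' (i + 1)) :
    ∃ v : ℕ → P, v 0 = x ∧ v (k + l) = z ∧ (∀ i < k + l, v i ⋖ v (i + 1)) ∧
      (∀ i ≤ k, v i = w i) ∧ ∀ i, v (k + i) = w' i := by
  -- At the seam `i = 0` the first branch applies, and both pieces take the value `y` there.
  have hr : ∀ i, (if k + i ≤ k then w (k + i) else w' (k + i - k)) = w' i := by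
    intro i
    split_ifs with h
    · have : i = 0 := by omega
      subst this
      rw [add_zero, h1, h0']
    · congr 1
      omega
  refine ⟨fun i => if i ≤ k then w i else w' (i - k), ?_, ?_, ?_, ?_, ?_⟩
  · simpa using h0
  · exact (hr l).trans h1'
  · intro i hi
    by_cases h : i < k
    · simpa [h.le, Nat.succ_le_of_lt h] using hw i h
    · obtain ⟨j, rfl⟩ := Nat.exists_eq_add_of_le (not_lt.1 h)
      have h2 := hr j
      have h3 := hr (j + 1)
      simp only [← add_assoc] at h3
      simp only [h2, h3]
      exact hw' j (by omega)
  · intro i hi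
    simp [hi]
  · exact hr

/-- There is a maximal chain through two given comparable elements. -/
theorem exists_maxChain_of_le [Finite P] [GradeMinOrder ℕ P] (hn : grade ℕ (⊤ : P) = n) {x y : P}
    (hxy : x ≤ y) : ∃ c : MaxChain P n, c.nth (grade ℕ x) = x ∧ c.nth (grade ℕ y) = y := by
  have hx : grade ℕ x ≤ grade ℕ y := grade_mono hxy
  have hy : grade ℕ y ≤ n := hn ▸ grade_mono le_top
  obtain ⟨k, hk⟩ := Nat.exists_eq_add_of_le hx
  obtain ⟨l, hl⟩ := Nat.exists_eq_add_of_le hy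
  obtain ⟨w₁, a₁, b₁, c₁⟩ := exists_saturated (grade ℕ x) ⊥ x bot_le (by simp)
  obtain ⟨w₂, a₂, b₂, c₂⟩ := exists_saturated k x y hxy hk
  obtain ⟨w₃, a₃, b₃, c₃⟩ := exists_saturated l y ⊤ le_top (by omega)
  obtain ⟨v, av, bv, cv, dv, ev⟩ := exists_saturated_trans a₁ b₁ c₁ a₂ b₂ c₂
  obtain ⟨u, au, bu, cu, du, eu⟩ := exists_saturated_trans av bv cv a₃ b₃ c₃
  refine ⟨⟨fun i => u i, au, ?_, fun i => cu i (by omega)⟩, ?_, ?_⟩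
  · rw [← bu]
    simp only [Fin.val_last]
    congr 1
    omega
  · rw [MaxChain.nth_eq _ (hx.trans hy)]
    change u (grade ℕ x) = x
    rw [du _ (by omega), dv _ le_rfl, b₁]
  · rw [MaxChain.nth_eq _ hy]
    change u (grade ℕ y) = y
    rw [hk, du _ le_rfl, bv]

end Chains

/-! ### Extending initial chains with increasing labels -/

section Completions

variable {P : Type*} [PartialOrder P] [BoundedOrder P] {n : ℕ} {L : Type*}

/-- The values of `f` on `S` are increasing for the relation `rel`. -/
def IncreasingOn (rel : L → L → Prop) (f : Fin n → L) (S : Set (Fin n)) : Prop :=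
  ∀ i ∈ S, ∀ j ∈ S, i < j → rel (f i) (f j)

theorem IncreasingOn.congr {rel : L → L → Prop} {f g : Fin n → L} {S : Set (Fin n)}
    (hf : IncreasingOn rel f S) (h : ∀ i ∈ S, f i = g i) : IncreasingOn rel g S := by
  intro i hi j hj hij
  rw [← h i hi, ← h j hj]
  exact hf i hi j hj hij

/-- A common generalization of `R`-labelings and `R*`-labelings. -/
def IsIncreasingLabeling [GradeMinOrder ℕ P] (rel : L → L → Prop)
    (Λ : MaxChain P n → Fin n → L) : Prop :=
  IsCLabeling Λ ∧ ∀ (c : MaxChain P n) (r s : Fin (n + 1)) (u : P),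
    c.elt r < u → grade ℕ u = (s : ℕ) →
      ∃! v : Set.Iic s → P, ∃ c' : MaxChain P n,
        IsCompletion c r s u v c' ∧ IncreasingOn rel (Λ c') (labelPositions r s)

theorem IsRLabeling.isIncreasingLabeling [GradeMinOrder ℕ P] [LinearOrder L]
    {Λ : MaxChain P n → Fin n → L} (h : IsRLabeling Λ) : IsIncreasingLabeling (· ≤ ·) Λ := by
  simpa only [IsIncreasingLabeling, IsRLabeling, IncreasingOn, ← monotoneOn_iff_forall_lt] using h

theorem IsRStarLabeling.isIncreasingLabeling [GradeMinOrder ℕ P] [LinearOrder L]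
    {Λ : MaxChain P n → Fin n → L} (h : IsRStarLabeling Λ) :
    IsIncreasingLabeling (· < ·) Λ := by
  refine ⟨h.1, fun c r s u hr hu => ?_⟩
  convert h.2 c r s u hr hu using 6
  exact ⟨fun h i hi j hj => h i hi j hj, fun h i hi j hj => h hi hj⟩

variable [GradeMinOrder ℕ P] {rel : L → L → Prop} {Λ : MaxChain P n → Fin n → L}

/-- Initial parts of maximal chains can be continued to a given element with increasing labels. -/
theorem IsIncreasingLabeling.exists_extension (hΛ : IsIncreasingLabeling rel Λ)
    (c : MaxChain P n) {r s : ℕ} (hrs : r ≤ s) (hs : s ≤ n) (u : P) (hu : c.nth r ≤ u)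
    (hg : grade ℕ u = s) :
    ∃ c' : MaxChain P n, (∀ k ≤ r, c'.nth k = c.nth k) ∧
      (∀ i : Fin n, i.val < r → Λ c' i = Λ c i) ∧ c'.nth s = u ∧
      IncreasingOn rel (Λ c') {i | r ≤ i.val ∧ i.val < s} := by
  -- The labeling axiom speaks only of `w r < u`; an empty block, `r = s`, needs no extension and is
  -- treated separately.
  rcases hrs.eq_or_lt with rfl | hlt
  · refine ⟨c, fun _ _ => rfl, fun _ _ => rfl, ?_, fun i hi => ?_⟩
    · exact eq_of_le_of_grade_eq hu (by rw [c.grade_nth hs, hg])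
    · have := hi.1
      have := hi.2
      omega
  · have hr : r ≤ n := hrs.trans hs
    have hu' : c.elt ⟨r, Nat.lt_succ_of_le hr⟩ < u := by
      rw [← c.nth_eq hr]
      refine lt_of_le_of_ne hu fun h => ?_
      rw [← h, c.grade_nth hr] at hg
      omega
    obtain ⟨v, ⟨c', ⟨h1, h2, h3⟩, h4⟩, -⟩ :=
      hΛ.2 c ⟨r, Nat.lt_succ_of_le hr⟩ ⟨s, Nat.lt_succ_of_le hs⟩ u hu' hg
    have h5 : ∀ j : Fin (n + 1), j.val ≤ r → c'.elt j = c.elt j := by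
      intro j hj
      have hjs : j ∈ Set.Iic (⟨s, Nat.lt_succ_of_le hs⟩ : Fin (n + 1)) :=
        Fin.le_def.2 (hj.trans hrs)
      rw [← h3 ⟨j, hjs⟩, h1 ⟨j, hjs⟩ (Fin.le_def.2 hj)]
    refine ⟨c', fun k hk => h5 _ ((min_le_left _ _).trans hk), fun i hi => ?_, ?_, ?_⟩
    · refine hΛ.1 _ _ _ fun j hj => h5 j ?_
      have := Fin.le_def.1 hj
      simp only [Fin.val_succ] at this
      omega
    · rw [c'.nth_eq hs, ← h2, h3]
    · intro i hi j hj hij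
      refine h4 i ⟨Fin.le_def.2 hi.1, Fin.le_def.2 ?_⟩ j ⟨Fin.le_def.2 hj.1, Fin.le_def.2 ?_⟩ hij
      · simpa using hi.2
      · simpa using hj.2

/-- The parts of `c` and `c'` up to rank `s` are both increasing completions of the same initial
chain to the same element, so uniqueness of completions applies. -/
theorem IsIncreasingLabeling.unique_extension (hΛ : IsIncreasingLabeling rel Λ)
    {c c' : MaxChain P n} {r s : ℕ} (hrs : r ≤ s) (hs : s ≤ n)
    (h : ∀ k ≤ r, c.nth k = c'.nth k) (hcs : c.nth s = c'.nth s)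
    (hc : IncreasingOn rel (Λ c) {i | r ≤ i.val ∧ i.val < s})
    (hc' : IncreasingOn rel (Λ c') {i | r ≤ i.val ∧ i.val < s}) :
    ∀ k ≤ s, c.nth k = c'.nth k := by
  rcases hrs.eq_or_lt with rfl | hlt
  · exact h
  · have hr : r ≤ n := hrs.trans hs
    have hlt' : c.elt ⟨r, Nat.lt_succ_of_le hr⟩ < c.elt ⟨s, Nat.lt_succ_of_le hs⟩ :=
      c.strictMono (Fin.mk_lt_mk.2 hlt)
    have hpos : ∀ {f : Fin n → L}, IncreasingOn rel f {i | r ≤ i.val ∧ i.val < s} →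
        IncreasingOn rel f (labelPositions ⟨r, Nat.lt_succ_of_le hr⟩ ⟨s, Nat.lt_succ_of_le hs⟩) := by
      intro f hf i hi j hj
      have h1 := Fin.le_def.1 hi.2
      have h2 := Fin.le_def.1 hj.2
      simp only [Fin.val_succ] at h1 h2
      exact hf i ⟨Fin.le_def.1 hi.1, by omega⟩ j ⟨Fin.le_def.1 hj.1, by omega⟩
    have huniq := (hΛ.2 c _ _ _ hlt' (c.grade_elt _)).unique
      (y₁ := fun j => c.elt j) (y₂ := fun j => c'.elt j)
      ⟨c, ⟨fun _ _ => rfl, rfl, fun _ => rfl⟩, hpos hc⟩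
      ⟨c', ⟨fun j hj => ?_, ?_, fun _ => rfl⟩, hpos hc'⟩
    · intro k hk
      have := congrFun huniq ⟨⟨k, by omega⟩, Fin.le_def.2 hk⟩
      rw [c.nth_eq (hk.trans hs), c'.nth_eq (hk.trans hs)]
      exact this
    · have hj' := Fin.le_def.1 hj
      have := h j.1.1 hj'
      rw [c.nth_eq (hj'.trans hr), c'.nth_eq (hj'.trans hr)] at this
      exact this.symm
    · rw [c.nth_eq hs, c'.nth_eq hs] at hcs
      exact hcs.symm

theorem MaxChain.ext_nth {c c' : MaxChain P n} (h : ∀ k ≤ n, c.nth k = c'.nth k) : c = c' := by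
  refine MaxChain.ext (funext fun i => ?_)
  have hi : i.val ≤ n := Nat.lt_succ_iff.1 i.2
  have := h i hi
  rwa [c.nth_eq hi, c'.nth_eq hi] at this

end Completions

/-! ### Coefficients of `F_P` as counts of chains with increasing blocks -/

section FlagSeries

variable {P : Type*} [PartialOrder P] [BoundedOrder P] [Finite P] [GradeMinOrder ℕ P] {n : ℕ}
  {L : Type*} {rel : L → L → Prop} {Λ : MaxChain P n → Fin n → L}

theorem degree_eq_sum_range (d : ℕ →₀ ℕ) {K : ℕ} (hK : ∀ i, K ≤ i → d i = 0) :
    d.degree = ∑ j ∈ Finset.range K, d j := by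
  rw [Finsupp.degree_apply]
  refine Finset.sum_subset (fun i hi => ?_) fun i _ hi => Finsupp.notMem_support_iff.1 hi
  rw [Finset.mem_range]
  by_contra h
  exact Finsupp.mem_support_iff.1 hi (hK i (not_lt.1 h))

theorem exists_forall_ge_eq_zero (d : ℕ →₀ ℕ) : ∃ K, ∀ i, K ≤ i → d i = 0 := by
  refine ⟨d.support.sup id + 1, fun i hi => ?_⟩
  by_contra h
  have := Finset.le_sup (f := id) (Finsupp.mem_support_iff.2 h)
  simp only [id] at this
  omega

theorem sum_range_le_degree (d : ℕ →₀ ℕ) (k : ℕ) : ∑ j ∈ Finset.range k, d j ≤ d.degree := by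
  obtain ⟨K, hK⟩ := exists_forall_ge_eq_zero d
  rw [degree_eq_sum_range d (K := max K k) fun i hi => hK i (le_of_max_le_left hi)]
  exact Finset.sum_le_sum_of_subset (Finset.range_subset_range.2 (le_max_right _ _))

/-- The labels of `c` increase between the ranks `d 0 + ⋯ + d (k - 1)` and `d 0 + ⋯ + d k`. -/
def IsBlockIncreasing (rel : L → L → Prop) (d : ℕ →₀ ℕ) (f : Fin n → L) : Prop :=
  ∀ k, IncreasingOn rel f
    {i | ∑ j ∈ Finset.range k, d j ≤ i.val ∧ i.val < ∑ j ∈ Finset.range (k + 1), d j}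

/-- The chain is built block by block, each time extending the initial part that ends at the
previous `t k`. An extension keeps the initial part, hence by the C-property also its labels, so the
earlier blocks stay increasing. -/
theorem IsIncreasingLabeling.exists_chain (hn : grade ℕ (⊤ : P) = n)
    (hΛ : IsIncreasingLabeling rel Λ) (d : ℕ →₀ ℕ)
    (hd : d.degree = n) (t : ℕ → P) (ht : Monotone t)
    (hg : ∀ i, grade ℕ (t i) = ∑ j ∈ Finset.range (i + 1), d j) (K : ℕ) :
    ∃ c : MaxChain P n, ∀ k < K, c.nth (∑ j ∈ Finset.range (k + 1), d j) = t k ∧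
      IncreasingOn rel (Λ c)
        {i | ∑ j ∈ Finset.range k, d j ≤ i.val ∧ i.val < ∑ j ∈ Finset.range (k + 1), d j} := by
  have hmono : Monotone fun k => ∑ j ∈ Finset.range k, d j := fun a b hab =>
    Finset.sum_le_sum_of_subset (Finset.range_subset_range.2 hab)
  induction K with
  | zero =>
    obtain ⟨c, -⟩ := exists_maxChain_of_le hn (le_refl (⊥ : P))
    exact ⟨c, by simp⟩
  | succ K ih =>
    obtain ⟨c, hc⟩ := ih
    -- Before the first block the chain stands at `⊥`; afterwards it stands at the preceding element
    -- of the multichain.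
    have hle : c.nth (∑ j ∈ Finset.range K, d j) ≤ t K := by
      rcases K with _ | K
      · rw [Finset.sum_range_zero, c.nth_eq (Nat.zero_le n)]
        exact c.bot_eq.le.trans bot_le
      · rw [(hc K (Nat.lt_succ_self K)).1]
        exact ht (Nat.le_succ K)
    obtain ⟨c', h1, h2, h3, h4⟩ := hΛ.exists_extension c (hmono (Nat.le_succ K))
      (hd ▸ sum_range_le_degree d (K + 1)) (t K) hle (hg K)
    refine ⟨c', fun k hk => ?_⟩
    rcases Nat.lt_succ_iff_lt_or_eq.1 hk with hk | rfl
    · have hkK : ∑ j ∈ Finset.range (k + 1), d j ≤ ∑ j ∈ Finset.range K, d j := hmono hk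
      rw [h1 _ hkK]
      refine ⟨(hc k hk).1, (hc k hk).2.congr fun i hi => (h2 i ?_).symm⟩
      exact lt_of_lt_of_le hi.2 hkK
    · exact ⟨h3, h4⟩

/-- Agreement propagates from one block to the next by `unique_extension`, and the finitely many
nonempty blocks cover all ranks up to `n`. -/
theorem IsIncreasingLabeling.chain_unique (hΛ : IsIncreasingLabeling rel Λ) (d : ℕ →₀ ℕ)
    (hd : d.degree = n) {c c' : MaxChain P n}
    (h : ∀ k, c.nth (∑ j ∈ Finset.range (k + 1), d j) = c'.nth (∑ j ∈ Finset.range (k + 1), d j))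
    (hc : IsBlockIncreasing rel d (Λ c)) (hc' : IsBlockIncreasing rel d (Λ c')) : c = c' := by
  have key : ∀ K, ∀ k ≤ ∑ j ∈ Finset.range K, d j, c.nth k = c'.nth k := by
    intro K
    induction K with
    | zero =>
      intro k hk
      rw [Finset.sum_range_zero, Nat.le_zero] at hk
      rw [hk, c.nth_eq (Nat.zero_le n), c'.nth_eq (Nat.zero_le n)]
      exact c.bot_eq.trans c'.bot_eq.symm
    | succ K ih =>
      exact hΛ.unique_extension
        (Finset.sum_le_sum_of_subset (Finset.range_subset_range.2 (Nat.le_succ K)))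
        (hd ▸ sum_range_le_degree d (K + 1)) ih (h K) (hc K) (hc' K)
  obtain ⟨K, hK⟩ := exists_forall_ge_eq_zero d
  refine MaxChain.ext_nth fun k hk => key K k ?_
  rwa [← degree_eq_sum_range d hK, hd]

/-- The coefficients of the flag series count the maximal chains with increasing blocks. -/
theorem IsIncreasingLabeling.coeff_flagSeries (hn : grade ℕ (⊤ : P) = n)
    (hΛ : IsIncreasingLabeling rel Λ) (d : ℕ →₀ ℕ) (hd : d.degree = n) :
    MvPowerSeries.coeff d (flagSeries ℂ P) =
      Nat.card {c : MaxChain P n // IsBlockIncreasing rel d (Λ c)} := by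
  obtain ⟨K, hK⟩ := exists_forall_ge_eq_zero d
  have hle : ∀ k, ∑ j ∈ Finset.range k, d j ≤ n := fun k => hd ▸ sum_range_le_degree d k
  have hKn : ∀ k, K ≤ k → ∑ j ∈ Finset.range k, d j = n := fun k hk => by
    rw [← degree_eq_sum_range d fun i hi => hK i (hk.trans hi), hd]
  change ((Nat.card _ : ℕ) : ℂ) = _
  congr 1
  symm
  refine Nat.card_eq_of_bijective
    (fun c => ⟨fun i => c.1.nth (∑ j ∈ Finset.range (i + 1), d j), ?_, ⟨K, ?_⟩, ?_⟩) ⟨?_, ?_⟩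
  · intro a b hab
    exact c.1.nth_monotone
      (Finset.sum_le_sum_of_subset (Finset.range_subset_range.2 (Nat.succ_le_succ hab)))
  · intro i hi
    simp only
    rw [hKn _ (hi.trans (Nat.le_succ i)), c.1.nth_eq le_rfl]
    exact c.1.top_eq
  · intro i
    exact c.1.grade_nth (hle _)
  · intro c c' h
    exact Subtype.ext (hΛ.chain_unique d hd (fun k => congrFun (congrArg Subtype.val h) k)
      c.2 c'.2)
  · rintro ⟨t, ht, ht', hg⟩
    obtain ⟨c, hc⟩ := hΛ.exists_chain hn d hd t ht hg K
    refine ⟨⟨c, fun k => ?_⟩, Subtype.ext (funext fun k => ?_)⟩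
    -- From `K` on the blocks are empty, since they would start at position `n`.
    · rcases lt_or_ge k K with hk | hk
      · exact (hc k hk).2
      · intro i hi
        have h1 := hi.1
        rw [hKn k hk] at h1
        omega
    · rcases lt_or_ge k K with hk | hk
      · exact (hc k hk).1
      · have hk' := hKn (k + 1) (hk.trans (Nat.le_succ k))
        simp only
        rw [hk', c.nth_eq le_rfl]
        refine c.top_eq.trans (eq_of_le_of_grade_eq le_top ?_).symm
        rw [hg, hk', hn]

/-- A counted multichain eventually equals `⊤`, so its rank jumps must add up to `n`. -/
theorem coeff_flagSeries_of_degree_ne (hn : grade ℕ (⊤ : P) = n) (d : ℕ →₀ ℕ)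
    (hd : d.degree ≠ n) : MvPowerSeries.coeff d (flagSeries ℂ P) = 0 := by
  change ((Nat.card _ : ℕ) : ℂ) = 0
  rw [Nat.cast_eq_zero, Nat.card_eq_zero]
  left
  refine ⟨?_⟩
  rintro ⟨t, -, ⟨k, hk⟩, hg⟩
  apply hd
  obtain ⟨K, hK⟩ := exists_forall_ge_eq_zero d
  rw [degree_eq_sum_range d (K := max K k + 1) fun i hi => hK i (by omega), ← hg,
    hk _ (le_max_right _ _), hn]

end FlagSeries

/-! ### Block indices and lexicographically sorted arrays -/

section Blocks

variable {n : ℕ} {L : Type*}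

/-- The weakly increasing sequence with `d k` entries equal to `k`. -/
theorem exists_blockIndex (d : ℕ →₀ ℕ) (hd : d.degree = n) :
    ∃ β : Fin n → ℕ, Monotone β ∧ univ.val.map β = Finsupp.toMultiset d ∧
      ∀ i k, β i = k ↔ ∑ j ∈ Finset.range k, d j ≤ i.val ∧
        i.val < ∑ j ∈ Finset.range (k + 1), d j := by
  obtain ⟨β, hβ, hm⟩ := exists_monotone_map_univ_eq (n := n) (Finsupp.toMultiset d) (by
    rw [Finsupp.card_toMultiset, ← hd]
    rfl)
  have hcard : ∀ k, #{i | β i = k} = d k := by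
    intro k
    rw [← Finsupp.count_toMultiset, ← hm, Multiset.count_map]
    simp only [eq_comm (a := k)]
    rfl
  have hle : ∀ k, #{i | β i ≤ k} = ∑ j ∈ Finset.range (k + 1), d j := by
    intro k
    rw [Finset.card_eq_sum_card_fiberwise (f := β) (t := Finset.range (k + 1))]
    · refine Finset.sum_congr rfl fun j hj => ?_
      rw [← hcard j, Finset.filter_filter]
      congr 1
      ext i
      simp only [Finset.mem_filter, Finset.mem_univ, true_and, and_iff_right_iff_imp]
      rintro rfl
      exact Nat.lt_succ_iff.1 (Finset.mem_range.1 hj)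
    · intro i hi
      simpa [Nat.lt_succ_iff] using hi
  -- Since `β` is sorted, its entries at most `k` occupy an initial segment, whose length is the
  -- number of such entries.
  have hlt : ∀ (i : Fin n) k, β i ≤ k ↔ i.val < ∑ j ∈ Finset.range (k + 1), d j := by
    intro i k
    rw [← hle k, ← Tuple.lt_card_le_iff_apply_le_of_monotone hβ]
  refine ⟨β, hβ, hm, fun i k => ?_⟩
  rcases k with _ | k
  · rw [← hlt]
    simp
  · rw [← hlt, ← not_lt, ← hlt]
    omega

theorem isBlockIncreasing_iff {rel : L → L → Prop} {d : ℕ →₀ ℕ} {β : Fin n → ℕ}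
    (hβ : ∀ i k, β i = k ↔ ∑ j ∈ Finset.range k, d j ≤ i.val ∧
        i.val < ∑ j ∈ Finset.range (k + 1), d j) (f : Fin n → L) :
    IsBlockIncreasing rel d f ↔ ∀ i j, i < j → β i = β j → rel (f i) (f j) := by
  constructor
  · intro h i j hij he
    exact h (β j) i ((hβ i _).1 he) j ((hβ j _).1 rfl) hij
  · intro h k i hi j hj hij
    exact h i j hij (((hβ i k).2 hi).trans ((hβ j k).2 hj).symm)

variable [LinearOrder L]

theorem monotone_lex_iff {β : Fin n → ℕ} (hβ : Monotone β) (f : Fin n → L) :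
    Monotone (fun i => toLex (β i, f i)) ↔ ∀ i j, i < j → β i = β j → f i ≤ f j := by
  rw [monotone_iff_forall_lt]
  refine forall₃_congr fun i j hij => ?_
  have := hβ hij.le
  rw [Prod.Lex.toLex_le_toLex]
  constructor
  · rintro (h | h) he
    · exact absurd he h.ne
    · exact h.2
  · intro h
    rcases this.lt_or_eq with h' | h'
    · exact Or.inl h'
    · exact Or.inr ⟨h', h h'⟩

/-- Strict increase inside blocks is weak increase without repeated pairs. This is the point where
0-1 matrices, and hence the `e_k`, replace arbitrary matrices and the `h_k`. -/
theorem monotone_lex_and_injective_iff {β : Fin n → ℕ} (hβ : Monotone β) (f : Fin n → L) :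
    (Monotone (fun i => toLex (β i, f i)) ∧ Function.Injective fun i => (β i, f i)) ↔
      ∀ i j, i < j → β i = β j → f i < f j := by
  rw [monotone_lex_iff hβ]
  constructor
  · rintro ⟨h1, h2⟩ i j hij he
    refine lt_of_le_of_ne (h1 i j hij he) fun h => hij.ne (h2 (Prod.ext he h))
  · intro h
    refine ⟨fun i j hij he => (h i j hij he).le, fun i j hij => ?_⟩
    by_contra hne
    have h1 := congrArg Prod.fst hij
    have h2 := congrArg Prod.snd hij
    rcases lt_or_gt_of_ne hne with h' | h'
    · exact (h i j h' h1).ne h2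
    · exact (h j i h' h1.symm).ne h2.symm

theorem exists_lexMonotone_map_univ_eq (m : Multiset (ℕ × L)) (hm : m.card = n) :
    ∃ g : Fin n → ℕ × L, Monotone (fun i => toLex (g i)) ∧ univ.val.map g = m := by
  obtain ⟨f, hf, hfm⟩ := exists_monotone_map_univ_eq (n := n) (m.map toLex) (by
    rw [Multiset.card_map, hm])
  refine ⟨fun i => ofLex (f i), hf, ?_⟩
  have := congrArg (Multiset.map ofLex) hfm
  rw [Multiset.map_map, Multiset.map_map] at this
  simpa [Function.comp_def] using this

end Blocks

theorem marginals_eq_empty_of_degree_ne {n : ℕ} {L : Type*} [DecidableEq L] (d : ℕ →₀ ℕ)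
    (hd : d.degree ≠ n) {M : Multiset L}
    (hM : M.card = n) : marginals d M = ∅ := by
  rw [Set.eq_empty_iff_forall_notMem]
  rintro m ⟨h1, h2⟩
  apply hd
  rw [← hM, ← h2, Multiset.card_map, ← Multiset.card_map Prod.fst, h1, Finsupp.card_toMultiset]
  rfl

/-! ### The expansions of `F_P` for RS- and R*S-labelings -/

section Counting

variable {P : Type*} [PartialOrder P] [BoundedOrder P] [Finite P] {n : ℕ}
  {L : Type*} [LinearOrder L] {Λ : MaxChain P n → Fin n → L}

/-- Sorting identifies the sorted label sequences with matrices. -/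
theorem IsSLabeling.card_sorted (hS : IsSLabeling Λ) (d : ℕ →₀ ℕ) {β : Fin n → ℕ}
    (hβ : Monotone β) (hβd : univ.val.map β = Finsupp.toMultiset d)
    (q : Set (Multiset (ℕ × L))) :
    Nat.card {c : MaxChain P n // Monotone (fun i => toLex (β i, Λ c i)) ∧
      univ.val.map (fun i => (β i, Λ c i)) ∈ q} =
    {m ∈ q | ∃ M ∈ labelMultisets Λ, m ∈ marginals d M}.ncard := by
  refine Nat.card_eq_of_bijective (β := {m ∈ q | ∃ M ∈ labelMultisets Λ, m ∈ marginals d M})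
    (fun c => ⟨univ.val.map (fun i => (β i, Λ c.1 i)), c.2.2, _,
      mem_labelMultisets.2 ⟨c.1, rfl⟩, ?_, ?_⟩) ⟨?_, ?_⟩
  · rw [Multiset.map_map]
    exact hβd
  · rw [Multiset.map_map]
    rfl
  · intro c c' h
    have h1 := Monotone.eq_of_map_univ_eq c.2.1 c'.2.1 (congrArg Subtype.val h)
    exact Subtype.ext (hS.1 (funext fun i => congrArg (fun x => (ofLex x).2) (congrFun h1 i)))
  · rintro ⟨m, hq, M, hM, h1, h2⟩
    obtain ⟨c, rfl⟩ := mem_labelMultisets.1 hM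
    obtain ⟨g, hg, rfl⟩ := exists_lexMonotone_map_univ_eq (n := n) m (by
      rw [← Multiset.card_map Prod.snd, h2]
      simp)
    rw [Multiset.map_map] at h1 h2
    have hfst : Prod.fst ∘ g = β :=
      Monotone.eq_of_map_univ_eq (fun i j hij => Prod.Lex.monotone_fst _ _ (hg hij)) hβ
        (h1.trans hβd.symm)
    -- The lower line of the sorted array rearranges the labels of `c`, so by closure under
    -- permutations it is the label word of a chain.
    obtain ⟨τ, hτ⟩ := exists_eq_comp_perm_of_map_univ_eq h2.symm
    obtain ⟨c', hc'⟩ := hS.exists_eq_comp τ c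
    have hsnd : Λ c' = Prod.snd ∘ g := hc'.trans hτ.symm
    have hgeq : (fun i => (β i, Λ c' i)) = g := by
      rw [← hfst, hsnd]
      rfl
    refine ⟨⟨c', ?_, ?_⟩, Subtype.ext (congrArg (fun f => univ.val.map f) hgeq)⟩
    · intro i j hij
      have := hg hij
      rwa [← hgeq] at this
    · rw [hgeq]
      exact hq

variable [GradeMinOrder ℕ P]

theorem IsSLabeling.flagSymmFun_eq_of_isRLabeling (hn : grade ℕ (⊤ : P) = n)
    (hF : IsFlagSymmetric P) (hS : IsSLabeling Λ) (hR : IsRLabeling Λ) :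
    flagSymmFun hF = ∑ M ∈ labelMultisets Λ, completeMult M := by
  apply Subtype.ext
  ext d
  rw [coeff_sum]
  simp only [coeff_completeMult]
  change MvPowerSeries.coeff d (flagSeries ℂ P) = _
  by_cases hd : d.degree = n
  · obtain ⟨β, hβ, hβd, hβk⟩ := exists_blockIndex d hd
    rw [hR.isIncreasingLabeling.coeff_flagSeries hn d hd]
    simp only [isBlockIncreasing_iff hβk, ← monotone_lex_iff hβ]
    have h1 := hS.card_sorted d hβ hβd Set.univ
    rw [ncard_biUnion_of_subset_marginals] at h1
    simp only [Set.mem_univ, and_true, Set.ofPred_mem_eq] at h1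
    rw [h1, Nat.cast_sum]
  · rw [coeff_flagSeries_of_degree_ne hn d hd]
    refine (Finset.sum_eq_zero fun M hM => ?_).symm
    rw [marginals_eq_empty_of_degree_ne d hd (card_of_mem_labelMultisets hM)]
    simp

theorem IsSLabeling.flagSymmFun_eq_of_isRStarLabeling (hn : grade ℕ (⊤ : P) = n)
    (hF : IsFlagSymmetric P) (hS : IsSLabeling Λ) (hR : IsRStarLabeling Λ) :
    flagSymmFun hF = ∑ M ∈ labelMultisets Λ, elemMult M := by
  apply Subtype.ext
  ext d
  rw [coeff_sum]
  simp only [coeff_elemMult]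
  change MvPowerSeries.coeff d (flagSeries ℂ P) = _
  by_cases hd : d.degree = n
  · obtain ⟨β, hβ, hβd, hβk⟩ := exists_blockIndex d hd
    rw [hR.isIncreasingLabeling.coeff_flagSeries hn d hd]
    simp only [isBlockIncreasing_iff hβk, ← monotone_lex_and_injective_iff hβ]
    have h1 := hS.card_sorted d hβ hβd {m | m.Nodup}
    rw [ncard_biUnion_of_subset_marginals] at h1
    simp only [Set.mem_ofPred_eq, Fintype.nodup_map_univ_iff_injective] at h1
    rw [h1, Nat.cast_sum]
  · rw [coeff_flagSeries_of_degree_ne hn d hd]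
    refine (Finset.sum_eq_zero fun M hM => ?_).symm
    rw [marginals_eq_empty_of_degree_ne d hd (card_of_mem_labelMultisets hM)]
    simp

/-- The coefficient of `e_ν` is the number of `M` in `s` with multiplicities `ν`; the induction adds
one for each `M`. -/
theorem isEPositive_sum_elemMult (s : Finset (Multiset L)) (hs : ∀ M ∈ s, M.card = n) :
    IsEPositive n (∑ M ∈ s, elemMult M) := by
  induction s using Finset.induction_on with
  | empty => exact ⟨0, by simp⟩
  | insert M s hM ih =>
    obtain ⟨a, ha⟩ := ih fun M hM => hs M (Finset.mem_insert_of_mem hM)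
    refine ⟨a + Pi.single (multiplicities M (hs M (Finset.mem_insert_self M s))) 1, ?_⟩
    rw [Finset.sum_insert hM, ha, add_comm]
    simp only [Pi.add_apply, add_smul, Finset.sum_add_distrib]
    congr 1
    rw [Finset.sum_eq_single (multiplicities M (hs M (Finset.mem_insert_self M s)))]
    · rw [Pi.single_eq_same, one_smul, elemPart_multiplicities]
    · intro ν _ hν
      rw [Pi.single_eq_of_ne hν, zero_smul]
    · simp

end Counting

/-! ### Multisets of initial labels -/

section Prefixes

variable {n : ℕ} {L : Type*}

/-- The multiset of the first `r` entries of a tuple. -/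
def prefixMultiset (f : Fin n → L) (r : ℕ) : Multiset L :=
  (univ.filter fun i : Fin n => i.val < r).val.map f

/-- The entries of a tuple, with a mark that tells whether they are among the first `r`. -/
def splitAt (f : Fin n → L) (r : ℕ) (i : Fin n) : ℕ × L := (if i.val < r then 0 else 1, f i)

theorem prefixMultiset_congr {f g : Fin n → L} {r : ℕ} (h : ∀ i : Fin n, i.val < r → f i = g i) :
    prefixMultiset f r = prefixMultiset g r :=
  Multiset.map_congr rfl fun i hi => h i (by simpa using hi)

theorem prefixMultiset_mono (f : Fin n → L) : Monotone (prefixMultiset f) := by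
  intro r s hrs
  refine Multiset.map_le_map (Finset.val_le_iff.2 fun i hi => ?_)
  rw [Finset.mem_filter] at hi ⊢
  exact ⟨hi.1, hi.2.trans_le hrs⟩

theorem card_prefixMultiset (f : Fin n → L) {r : ℕ} (hr : r ≤ n) :
    (prefixMultiset f r).card = r := by
  rw [prefixMultiset, Multiset.card_map]
  exact Fin.card_filter_val_lt.trans (min_eq_right hr)

theorem prefixMultiset_self (f : Fin n → L) : prefixMultiset f n = univ.val.map f := by
  rw [prefixMultiset, Finset.filter_true_of_mem fun i _ => i.2]

/-- The initial multiset depends only on the content of the marked word, so sorting below and above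
`r` separately does not change it. -/
theorem prefixMultiset_eq_of_splitAt (f : Fin n → L) (r : ℕ) :
    prefixMultiset f r = ((univ.val.map (splitAt f r)).filter fun x => x.1 = 0).map Prod.snd := by
  rw [Multiset.filter_map, Multiset.map_map, prefixMultiset, Finset.filter_val]
  refine Multiset.map_congr (Multiset.filter_congr fun i _ => ?_) fun _ _ => rfl
  simp [splitAt]

theorem map_splitAt_eq [DecidableEq L] (f : Fin n → L) (r : ℕ) :
    univ.val.map (splitAt f r) = (prefixMultiset f r).map (Prod.mk 0) +
      (univ.val.map f - prefixMultiset f r).map (Prod.mk 1) := by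
  have h : univ.val.map f - prefixMultiset f r =
      (univ.val.filter fun i : Fin n => ¬ i.val < r).map f := by
    rw [prefixMultiset, Finset.filter_val, tsub_eq_iff_eq_add_of_le
      (Multiset.map_le_map (Multiset.filter_le _ _)), add_comm, ← Multiset.map_add,
      Multiset.filter_add_not]
  rw [h, prefixMultiset, Multiset.map_map, Multiset.map_map, Finset.filter_val]
  conv_lhs => rw [← Multiset.filter_add_not (fun i : Fin n => i.val < r) univ.val]
  rw [Multiset.map_add]
  congr 1
  · refine Multiset.map_congr rfl fun i hi => ?_
    simp [splitAt, (Multiset.mem_filter.1 hi).2]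
  · refine Multiset.map_congr rfl fun i hi => ?_
    simp only [splitAt, (Multiset.mem_filter.1 hi).2, if_false, Function.comp_apply]

theorem monotone_mark (r : ℕ) : Monotone fun i : Fin n => if i.val < r then 0 else 1 := by
  intro i j hij
  have := Fin.le_def.1 hij
  dsimp only
  split_ifs <;> omega

theorem prefixMultiset_of_lexMonotone [LinearOrder L] {g : Fin n → ℕ × L} (hg : Monotone fun i => toLex (g i))
    (a : ℕ) : prefixMultiset (Prod.snd ∘ g) (((univ.val.map g).filter fun x => x.1 ≤ a).card) =
      ((univ.val.map g).filter fun x => x.1 ≤ a).map Prod.snd := by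
  have hfst : Monotone (Prod.fst ∘ g) := fun i j hij => Prod.Lex.monotone_fst _ _ (hg hij)
  rw [Multiset.filter_map, Multiset.card_map, Multiset.map_map, prefixMultiset, Finset.filter_val]
  refine Multiset.map_congr (Multiset.filter_congr fun i _ => ?_) fun _ _ => rfl
  rw [← Finset.filter_val, Finset.card_val]
  have := Tuple.lt_card_le_iff_apply_le_of_monotone (j := i) (a := a) hfst
  exact this

/-- A tuple with prescribed entries and two prescribed initial parts. -/
theorem exists_prefixMultiset_eq [LinearOrder L] {N N' M : Multiset L} (h : N ≤ N') (h' : N' ≤ M)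
    (hM : M.card = n) : ∃ f : Fin n → L, univ.val.map f = M ∧ prefixMultiset f N.card = N ∧
      prefixMultiset f N'.card = N' := by
  obtain ⟨A, rfl⟩ := Multiset.le_iff_exists_add.1 h
  obtain ⟨B, rfl⟩ := Multiset.le_iff_exists_add.1 h'
  -- The marks 0, 1, 2 make the lexicographic sorting list `N` first, then `N' - N`, then `M - N'`.
  obtain ⟨g, hg, hgm⟩ := exists_lexMonotone_map_univ_eq (n := n)
    (N.map (Prod.mk 0) + A.map (Prod.mk 1) + B.map (Prod.mk 2)) (by simpa using hM)
  have h0 := prefixMultiset_of_lexMonotone hg 0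
  have h1 := prefixMultiset_of_lexMonotone hg 1
  rw [hgm] at h0 h1
  refine ⟨Prod.snd ∘ g, ?_, ?_, ?_⟩
  · rw [← Multiset.map_map, hgm]
    simp
  · simpa [Multiset.filter_map, Function.comp_def] using h0
  · simpa [Multiset.filter_map, Function.comp_def] using h1

end Prefixes

/-! ### Sorting chains, and recovering elements from their label multisets -/

section Sorting

variable {P : Type*} [PartialOrder P] [BoundedOrder P] [Finite P] {n : ℕ}
  {L : Type*} [LinearOrder L] {Λ : MaxChain P n → Fin n → L}

/-- The labels of a chain below and above a given rank can be sorted without changing the element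
of this rank. -/
theorem IsSLabeling.exists_sorted (hS : IsSLabeling Λ) (c : MaxChain P n) {r : ℕ} (hr : r ≤ n) :
    ∃ c' : MaxChain P n, c'.nth r = c.nth r ∧
      univ.val.map (splitAt (Λ c') r) = univ.val.map (splitAt (Λ c) r) ∧
      Monotone fun i => toLex (splitAt (Λ c') r i) := by
  -- Among the chains with the same element at rank `r` and the same marked content, take the one
  -- with lexicographically least label word: exchanging a descent away from rank `r` would make the
  -- word smaller.
  obtain ⟨c', ⟨h1, h2⟩, hmin⟩ := Set.exists_min_image
    {c' : MaxChain P n | c'.nth r = c.nth r ∧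
      univ.val.map (splitAt (Λ c') r) = univ.val.map (splitAt (Λ c) r)}
    (fun c' => toLex (Λ c')) (Set.toFinite _) ⟨c, rfl, rfl⟩
  refine ⟨c', h1, h2, ?_⟩
  rcases n with _ | n
  · exact fun i => i.elim0
  rw [Fin.monotone_iff_le_succ]
  intro i
  simp only [splitAt, Prod.Lex.toLex_le_toLex]
  -- The exchange of the positions `i` and `i + 1` alters the element of rank `i + 1`, so it is
  -- unavailable for `r = i + 1`. There the mark jumps from 0 to 1 and the order of the labels is
  -- irrelevant.
  by_cases hir : r = i.val + 1
  · left
    simp [hir]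
  have hmark : (if (i.castSucc : Fin (n + 1)).val < r then 0 else 1 : ℕ) =
      if (i.succ : Fin (n + 1)).val < r then 0 else 1 := by
    simp only [Fin.val_castSucc, Fin.val_succ]
    congr 1
    refine propext ?_
    omega
  refine Or.inr ⟨hmark, ?_⟩
  by_contra hlt
  rw [not_le] at hlt
  obtain ⟨c'', ⟨h3, h4⟩, -⟩ := hS.2 c' i.castSucc i.succ (by simp) hlt.ne'
  have h5 : splitAt (Λ c'') r = splitAt (Λ c') r ∘ Equiv.swap i.castSucc i.succ := by
    funext k
    simp only [splitAt, Function.comp_apply, h4, Prod.mk.injEq, and_true]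
    rw [Equiv.swap_apply_def]
    split_ifs with hk1 hk2 hk2
    all_goals simp_all
  have h6 := hmin c'' ⟨?_, ?_⟩
  · refine absurd h6 (not_le.2 ⟨i.castSucc, fun k hk => ?_, ?_⟩)
    · change Λ c'' k = Λ c' k
      rw [h4, Function.comp_apply, Equiv.swap_apply_of_ne_of_ne hk.ne]
      exact (hk.trans i.castSucc_lt_succ).ne
    · change Λ c'' _ < Λ c' _
      rw [h4, Function.comp_apply, Equiv.swap_apply_left]
      exact hlt
  · rw [← h1, MaxChain.nth_eq _ hr, MaxChain.nth_eq _ hr]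
    refine h3 _ fun h => hir ?_
    simpa using congrArg Fin.val h
  · rw [h5, map_univ_comp_perm, h2]

variable [GradeMinOrder ℕ P]

/-- After sorting, both chains increase weakly from `⊥` to the same element of rank `r`, so they
coincide up to there and carry the same labels by the C-property. Sorting preserved the initial
multisets. -/
theorem IsRLabeling.prefixMultiset_eq (hR : IsRLabeling Λ) (hS : IsSLabeling Λ)
    {c c' : MaxChain P n} {r : ℕ} (hr : r ≤ n) (h : c.nth r = c'.nth r) :
    prefixMultiset (Λ c) r = prefixMultiset (Λ c') r := by
  obtain ⟨b, h1, h2, h3⟩ := hS.exists_sorted c hr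
  obtain ⟨b', h1', h2', h3'⟩ := hS.exists_sorted c' hr
  have hinc : ∀ {f : Fin n → L}, (Monotone fun i => toLex (splitAt f r i)) →
      IncreasingOn (· ≤ ·) f {i | 0 ≤ i.val ∧ i.val < r} := by
    intro f hf i hi j hj hij
    refine (monotone_lex_iff (monotone_mark r) f).1 hf i j hij ?_
    rw [if_pos hi.2, if_pos hj.2]
  have h4 := hR.isIncreasingLabeling.unique_extension (c := b) (c' := b') (Nat.zero_le r) hr
    (fun k hk => by
      rw [Nat.le_zero.1 hk, MaxChain.nth_eq _ (Nat.zero_le n), MaxChain.nth_eq _ (Nat.zero_le n)]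
      exact b.bot_eq.trans b'.bot_eq.symm)
    (by rw [h1, h1', h]) (hinc h3) (hinc h3')
  have h5 : prefixMultiset (Λ b) r = prefixMultiset (Λ b') r := by
    refine prefixMultiset_congr fun i hi => hR.1 _ _ _ fun j hj => ?_
    have hj' := Fin.le_def.1 hj
    rw [Fin.val_succ] at hj'
    have := h4 j (by omega)
    rwa [MaxChain.nth_eq _ (by omega), MaxChain.nth_eq _ (by omega)] at this
  rw [prefixMultiset_eq_of_splitAt, ← h2, ← prefixMultiset_eq_of_splitAt, h5,
    prefixMultiset_eq_of_splitAt, h2', ← prefixMultiset_eq_of_splitAt]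

/-- All maximal chains end at `⊤`, so this is the case `r = n` of `prefixMultiset_eq`. -/
theorem IsRLabeling.map_label_eq (hR : IsRLabeling Λ) (hS : IsSLabeling Λ)
    (c c' : MaxChain P n) : univ.val.map (Λ c) = univ.val.map (Λ c') := by
  rw [← prefixMultiset_self, ← prefixMultiset_self]
  refine hR.prefixMultiset_eq hS le_rfl ?_
  rw [MaxChain.nth_eq _ le_rfl, MaxChain.nth_eq _ le_rfl]
  exact c.top_eq.trans c'.top_eq.symm

/-- As the total multiset is common, equal initial multisets give equal marked contents. Both chains
then sort to the same label word, hence to the same chain, and sorting kept the elements of rank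
`r`. -/
theorem IsRLabeling.nth_eq_of_prefixMultiset_eq (hR : IsRLabeling Λ) (hS : IsSLabeling Λ)
    {c c' : MaxChain P n} {r : ℕ} (hr : r ≤ n)
    (h : prefixMultiset (Λ c) r = prefixMultiset (Λ c') r) : c.nth r = c'.nth r := by
  obtain ⟨b, h1, h2, h3⟩ := hS.exists_sorted c hr
  obtain ⟨b', h1', h2', h3'⟩ := hS.exists_sorted c' hr
  have h4 : univ.val.map (splitAt (Λ b) r) = univ.val.map (splitAt (Λ b') r) := by
    rw [h2, h2', map_splitAt_eq, map_splitAt_eq, h, hR.map_label_eq hS c c']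
  have h5 := Monotone.eq_of_map_univ_eq h3 h3' h4
  have h6 : b = b' := hS.1 (funext fun i => congrArg (fun x => (ofLex x).2) (congrFun h5 i))
  rw [← h1, ← h1', h6]

/-- A poset with an `RS`-labeling is isomorphic to the submultisets of the multiset of labels. -/
theorem IsRLabeling.exists_labelMultiset (hn : grade ℕ (⊤ : P) = n) (hR : IsRLabeling Λ)
    (hS : IsSLabeling Λ) (M : Multiset L) (hM : M ∈ labelMultisets Λ) :
    ∃ Φ : P → Multiset L, (∀ x y, Φ x ≤ Φ y ↔ x ≤ y) ∧ ∀ N, N ≤ M ↔ ∃ x, Φ x = N := by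
  have hc : ∀ c, univ.val.map (Λ c) = M := by
    obtain ⟨c₀, rfl⟩ := mem_labelMultisets.1 hM
    exact fun c => hR.map_label_eq hS c c₀
  have hex : ∀ x : P, ∃ c : MaxChain P n, c.nth (grade ℕ x) = x := fun x =>
    (exists_maxChain_of_le hn (le_refl x)).imp fun c hc => hc.1
  have hgr : ∀ x : P, grade ℕ x ≤ n := fun x => hn ▸ grade_mono le_top
  choose ch hch using hex
  let Φ : P → Multiset L := fun x => prefixMultiset (Λ (ch x)) (grade ℕ x)
  -- The value of `Φ` does not depend on the chosen chain through the element.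
  have hΦ : ∀ (c : MaxChain P n) {r : ℕ} (_ : r ≤ n), Φ (c.nth r) = prefixMultiset (Λ c) r := by
    intro c r hr
    have hg := c.grade_nth hr
    have h1 := hch (c.nth r)
    simp only [Φ]
    rw [hg] at h1 ⊢
    exact hR.prefixMultiset_eq hS hr h1
  have hcard : ∀ x, (Φ x).card = grade ℕ x := fun x => card_prefixMultiset _ (hgr x)
  have hinj : Function.Injective Φ := by
    intro x y hxy
    have hg : grade ℕ x = grade ℕ y := by rw [← hcard, ← hcard, hxy]
    have hxy' : prefixMultiset (Λ (ch x)) (grade ℕ x) = prefixMultiset (Λ (ch y)) (grade ℕ y) := hxy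
    have := hR.nth_eq_of_prefixMultiset_eq hS (hgr x) (hxy'.trans (by rw [hg]))
    rw [hch] at this
    rw [this, hg, hch]
  have hle : ∀ x, Φ x ≤ M := by
    intro x
    rw [← hc (ch x), ← prefixMultiset_self]
    exact prefixMultiset_mono _ (hgr x)
  -- Realizing a nested pair on a single chain yields both surjectivity onto the submultisets and
  -- the reflection of the order.
  have hsub : ∀ N N', N ≤ N' → N' ≤ M → ∃ c : MaxChain P n,
      Φ (c.nth N.card) = N ∧ Φ (c.nth N'.card) = N' := by
    intro N N' h h'
    have hMn := card_of_mem_labelMultisets hM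
    have hN' : N'.card ≤ n := hMn ▸ Multiset.card_le_card h'
    obtain ⟨f, hf, h1, h2⟩ := exists_prefixMultiset_eq h h' hMn
    obtain ⟨c₀, hc₀⟩ := mem_labelMultisets.1 hM
    obtain ⟨σ, rfl⟩ := exists_eq_comp_perm_of_map_univ_eq (hc₀.trans hf.symm)
    obtain ⟨c, hcσ⟩ := hS.exists_eq_comp σ c₀
    rw [← hcσ] at h1 h2
    refine ⟨c, ?_, ?_⟩
    · rw [hΦ c ((Multiset.card_le_card h).trans hN'), h1]
    · rw [hΦ c hN', h2]
  refine ⟨Φ, fun x y => ⟨fun h => ?_, fun h => ?_⟩, fun N => ⟨fun h => ?_, ?_⟩⟩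
  · obtain ⟨c, h1, h2⟩ := hsub _ _ h (hle y)
    rw [← hinj h1, ← hinj h2]
    exact c.nth_monotone (Multiset.card_le_card h)
  · obtain ⟨c, h1, h2⟩ := exists_maxChain_of_le hn h
    rw [← h1, ← h2, hΦ c (hgr x), hΦ c (hgr y)]
    exact prefixMultiset_mono _ (grade_mono h)
  · obtain ⟨c, h1, -⟩ := hsub N N le_rfl h
    exact ⟨_, h1⟩
  · rintro ⟨x, rfl⟩
    exact hle x

end Sorting

/-! ### Submultisets as a product of chains -/

section Products

variable {L : Type*} [DecidableEq L]

theorem exists_equiv_multiplicities {n : ℕ} (M : Multiset L) (hM : M.card = n) :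
    ∃ e : (multiplicities M hM).parts.ToType ≃ M.toFinset, ∀ i, M.count (e i).1 = i.1 := by
  -- `ToType` attaches to each element an index below its multiplicity; without duplicates this
  -- index is always 0.
  have hbij : Function.Bijective fun a : M.toFinset.val.ToType =>
      (⟨a.1, Multiset.coe_mem⟩ : M.toFinset) := by
    constructor
    · rintro ⟨a, i⟩ ⟨b, j⟩ h
      obtain rfl : a = b := congrArg Subtype.val h
      have h1 := Multiset.nodup_iff_count_le_one.1 M.toFinset.nodup a
      congr 1
      apply Fin.ext
      omega
    · rintro ⟨a, ha⟩
      exact ⟨⟨a, ⟨0, Multiset.count_pos.2 ha⟩⟩, rfl⟩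
  obtain ⟨v, hv⟩ : ∃ v : M.toFinset.val.ToType ≃ (multiplicities M hM).parts.ToType,
      ∀ a, (v a).1 = M.count a.1 :=
    ⟨M.toFinset.val.mapEquiv M.count, Multiset.mapEquiv_apply M.toFinset.val M.count⟩
  refine ⟨v.symm.trans (Equiv.ofBijective _ hbij), fun i => ?_⟩
  obtain ⟨a, rfl⟩ := v.surjective i
  rw [hv, Equiv.trans_apply, Equiv.symm_apply_apply, Equiv.ofBijective_apply]

/-- The submultisets of a multiset form a product of chains. -/
theorem nonempty_orderIso_of_submultisets {P : Type*} [PartialOrder P] {n : ℕ} (M : Multiset L)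
    (hM : M.card = n) (Φ : P → Multiset L) (hΦ : ∀ x y, Φ x ≤ Φ y ↔ x ≤ y)
    (hsub : ∀ N, N ≤ M ↔ ∃ x, Φ x = N) :
    Nonempty (P ≃o ((i : (multiplicities M hM).parts.ToType) → Fin (i.1 + 1))) := by
  obtain ⟨e, he⟩ := exists_equiv_multiplicities M hM
  have hle : ∀ x, Φ x ≤ M := fun x => (hsub _).2 ⟨x, rfl⟩
  let Ψ : P → (i : (multiplicities M hM).parts.ToType) → Fin (i.1 + 1) := fun x i =>
    ⟨(Φ x).count (e i).1, Nat.lt_succ_of_le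
      ((Multiset.le_iff_count.1 (hle x) _).trans (he i).le)⟩
  have hΨ : ∀ x y, Ψ x ≤ Ψ y ↔ x ≤ y := by
    intro x y
    rw [← hΦ, Multiset.le_iff_count]
    constructor
    · intro h a
      by_cases ha : a ∈ M.toFinset
      · have := Fin.le_def.1 (h (e.symm ⟨a, ha⟩))
        simpa [Ψ] using this
      · rw [Multiset.count_eq_zero.2 fun h' => ha
          (Multiset.mem_toFinset.2 (Multiset.mem_of_le (hle x) h'))]
        exact Nat.zero_le _
    · exact fun h i => Fin.le_def.2 (h _)
  refine ⟨RelIso.ofSurjective (OrderEmbedding.ofMapLEIff Ψ hΨ) fun h => ?_⟩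
  -- A point of the product prescribes the multiplicity of each label, bounded by its multiplicity
  -- in `M`.
  let N : Multiset L := ∑ a : M.toFinset, (h (e.symm a)).val • {a.1}
  have hN : ∀ a : M.toFinset, N.count a.1 = h (e.symm a) := by
    intro a
    rw [Multiset.count_sum', Finset.sum_eq_single a]
    · simp
    · intro b _ hb
      rw [Multiset.count_nsmul, Multiset.count_singleton, if_neg fun h' => hb (Subtype.ext h'.symm)]
      simp
    · simp
  have hNM : N ≤ M := by
    rw [Multiset.le_iff_count]
    intro a
    by_cases ha : a ∈ M.toFinset
    · rw [hN ⟨a, ha⟩]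
      have h1 := he (e.symm ⟨a, ha⟩)
      rw [Equiv.apply_symm_apply] at h1
      have := (h (e.symm ⟨a, ha⟩)).2
      simp only at h1
      omega
    · rw [Multiset.count_eq_zero.2]
      · exact Nat.zero_le _
      · intro h'
        obtain ⟨b, -, hb⟩ := Multiset.mem_sum.1 h'
        rw [Multiset.mem_singleton.1 (Multiset.mem_of_mem_nsmul hb)] at ha
        exact ha b.2
  obtain ⟨x, hx⟩ := (hsub N).1 hNM
  refine ⟨x, funext fun i => Fin.ext ?_⟩
  change (Φ x).count (e i).1 = _
  rw [hx, hN, Equiv.symm_apply_apply]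

end Products

end FlagSymm

theorem theorem4p4 {P : Type*} [PartialOrder P] [BoundedOrder P] [Finite P] [GradeMinOrder ℕ P]
    {L : Type*} [LinearOrder L] (n : ℕ) (hn : grade ℕ (⊤ : P) = n)
    (hF : FlagSymm.IsFlagSymmetric P)
    (Λ : FlagSymm.MaxChain P n → Fin n → L) (hS : FlagSymm.IsSLabeling Λ) :
    (FlagSymm.IsRLabeling Λ → ∃ ν : n.Partition,
      FlagSymm.flagSymmFun hF = FlagSymm.frobeniusChar hS.chainCharacter ∧
      FlagSymm.frobeniusChar hS.chainCharacter = FlagSymm.completePart ℂ ν ∧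
      Nonempty (P ≃o ((i : ν.parts.ToType) → Fin (i.1 + 1)))) ∧
    (FlagSymm.IsRStarLabeling Λ →
      FlagSymm.frobeniusChar hS.chainCharacter = FlagSymm.omega ℂ (FlagSymm.flagSymmFun hF) ∧
      FlagSymm.IsEPositive n (FlagSymm.flagSymmFun hF)) := by
  refine ⟨fun hR => ?_, fun hR => ?_⟩
  · obtain ⟨c₀, -⟩ := FlagSymm.exists_maxChain_of_le hn (le_refl (⊥ : P))
    have hM : Finset.univ.val.map (Λ c₀) ∈ FlagSymm.labelMultisets Λ :=
      FlagSymm.mem_labelMultisets.2 ⟨c₀, rfl⟩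
    have hMs : FlagSymm.labelMultisets Λ = {Finset.univ.val.map (Λ c₀)} := by
      refine Finset.eq_singleton_iff_unique_mem.2 ⟨hM, fun N hN => ?_⟩
      obtain ⟨c, rfl⟩ := FlagSymm.mem_labelMultisets.1 hN
      exact hR.map_label_eq hS c c₀
    obtain ⟨Φ, h1, h2⟩ := hR.exists_labelMultiset hn hS _ hM
    refine ⟨FlagSymm.multiplicities _ (FlagSymm.card_of_mem_labelMultisets hM), ?_, ?_,
      FlagSymm.nonempty_orderIso_of_submultisets _ _ Φ h1 h2⟩
    · rw [hS.flagSymmFun_eq_of_isRLabeling hn hF hR, hS.frobeniusChar_chainCharacter]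
    · rw [hS.frobeniusChar_chainCharacter, hMs, Finset.sum_singleton,
        FlagSymm.completePart_multiplicities]
  · rw [hS.frobeniusChar_chainCharacter, hS.flagSymmFun_eq_of_isRStarLabeling hn hF hR]
    refine ⟨?_, FlagSymm.isEPositive_sum_elemMult _ fun M hM =>
      FlagSymm.card_of_mem_labelMultisets hM⟩
    rw [map_sum]
    exact Finset.sum_congr rfl fun M _ => (FlagSymm.omega_elemMult M).symm
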